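/- Let $n\ge 3$, $b>0$, $\nu>0$ and $\gamma\in(1,5/3]$. Then there are constants $\kappa_0>0$ and $C>0$, depending only on $n,b,\nu,\gamma$, such that the following holds for every $\kappa\in(0,\kappa_0]$. Let $\psi_0\in H^5(\mathbb R^n)\cap L^1(\mathbb R^n)$ and $\psi_1\in H^3(\mathbb R^n)\cap L^1(\mathbb R^n)$, and let $\psi_2=b\nu\Delta\psi_1+\Delta\psi_0$. Put $\delta=b\nu+(\gamma-1)\kappa$, and let $\psi$, $\psi^{(0)}$, $\psi^{I,1}$ be the solutions in $C([0,\infty);L^2(\mathbb R^n))$, in the sense of distributions in $x$, of the Cauchy problems $$\begin{cases}(\partial_t-\kappa\Delta)(\psi_{tt}-\Delta\psi-\delta\Delta\psi_t)+\kappa(\gamma-1)(b\nu-\kappa)\Delta^2\psi_t=0,\\ (\psi,\psi_t,\psi_{tt})(0,\cdot)=(\psi_0,\psi_1,\psi_2),\end{cases}$$ $$\begin{cases}\psi^{(0)}_{tt}-\Delta\psi^{(0)}-b\nu\Delta\psi^{(0)}_t=0,\\ (\psi^{(0)},\psi^{(0)}_t)(0,\cdot)=(\psi_0,\psi_1),\end{cases}$$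 $$\begin{cases}\psi^{I,1}_{tt}-\Delta\psi^{I,1}-b\nu\Delta\psi^{I,1}_t=(\gamma-1)\Delta\big(\psi^{(0)}_t-b\nu\Delta\psi^{(0)}\big),\\ (\psi^{I,1},\psi^{I,1}_t)(0,\cdot)=\big((1-\gamma)(\psi_1-b\nu\Delta\psi_0),0\big),\end{cases}$$ and for $t>0$ let $$\psi^{L,\kappa}(t,x)=\frac{\gamma-1}{(4\pi\kappa t)^{n/2}}\int_{\mathbb R^n}e^{-|x-y|^2/(4\kappa t)}\big(\psi_1(y)-b\nu\Delta\psi_0(y)\big)\,dy,\qquad \psi^{L,\kappa}(0,\cdot)=(\gamma-1)(\psi_1-b\nu\Delta\psi_0).$$ Then $$\sup_{t\in[0,\infty)}\Big\|\psi(t,\cdot)-\big(\psi^{(0)}(t,\cdot)+\kappa\psi^{I,1}(t,\cdot)+\kappa\psi^{L,\kappa}(t,\cdot)\big)\Big\|_{L^2}\le C\,\kappa\sqrt{\kappa}\,\Big(\|\psi_0\|_{H^5\cap L^1}+\|\psi_1\|_{H^3\cap L^1}\Big),$$ where $\|f\|_{H^s\cap L^1}=\|f\|_{H^s}+\|f\|_{L^1}$.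 -/

import Mathlib

open MeasureTheory Set
open scoped SchwartzMap FourierTransform Laplacian ENNReal

noncomputable section

/-- Complex-valued `L²(ℝⁿ)`; real-valued functions are a special case. -/
abbrev L2Space (n : ℕ) : Type := Lp ℂ 2 (volume : Measure (EuclideanSpace ℝ (Fin n)))

/-- Tempered distributions on `ℝⁿ`. -/
abbrev TDist (n : ℕ) : Type := 𝓢'(EuclideanSpace ℝ (Fin n), ℂ)

/-- `u' = ∂ₜ u` on `[0, ∞)` in the sense of tempered distributions in the space variable: for every
Schwartz function `φ` the scalar function `t ↦ ⟨u(t), φ⟩` is differentiable on `[0, ∞)`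
(one-sidedly at `0`) with derivative `⟨u'(t), φ⟩`. -/
def HasTimeDeriv {n : ℕ} (u u' : ℝ → TDist n) : Prop :=
  ∀ φ : 𝓢(EuclideanSpace ℝ (Fin n), ℂ), ∀ t : ℝ, 0 ≤ t →
    HasDerivWithinAt (fun s : ℝ => u s φ) (u' t φ) (Ici 0) t

/-- `ψ ∈ C([0, ∞); L²(ℝⁿ))` is a (distributional) solution of the linear Blackstock problem
`(∂ₜ - κ Δ)(ψₜₜ - Δψ - δ Δψₜ) + κ (γ - 1)(b ν - κ) Δ² ψₜ = 0`, where `δ = b ν + (γ - 1) κ`,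
with `ψ(0) = ψ₀`, `ψₜ(0) = ψ₁`, `ψₜₜ(0) = ψ₂`. -/
def IsBlackstockSolution {n : ℕ} (b ν γ κ : ℝ) (ψ₀ ψ₁ ψ₂ : TDist n) (ψ : ℝ → L2Space n) : Prop :=
  ContinuousOn ψ (Ici 0) ∧
  ∃ ψt ψtt ψttt : ℝ → TDist n,
    HasTimeDeriv (fun t => (ψ t : TDist n)) ψt ∧ HasTimeDeriv ψt ψtt ∧ HasTimeDeriv ψtt ψttt ∧
    (∀ t : ℝ, 0 ≤ t →
      (ψttt t - Δ (ψt t) - ((b * ν + (γ - 1) * κ : ℝ) : ℂ) • Δ (ψtt t))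
        - (κ : ℂ) • Δ (ψtt t - Δ (ψ t : TDist n) - ((b * ν + (γ - 1) * κ : ℝ) : ℂ) • Δ (ψt t))
        + ((κ * (γ - 1) * (b * ν - κ) : ℝ) : ℂ) • Δ (Δ (ψt t)) = 0) ∧
    (ψ 0 : TDist n) = ψ₀ ∧ ψt 0 = ψ₁ ∧ ψtt 0 = ψ₂

/-- `v ∈ C([0, ∞); L²(ℝⁿ))`, with time derivative `vt`, is a (distributional) solution of the
viscoelastic damped wave equation `vₜₜ - Δv - a Δvₜ = f` with `v(0) = v₀`, `vₜ(0) = v₁`. -/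
def IsViscoelasticSolution {n : ℕ} (a : ℝ) (v₀ v₁ : TDist n) (f : ℝ → TDist n)
    (v : ℝ → L2Space n) (vt : ℝ → TDist n) : Prop :=
  ContinuousOn v (Ici 0) ∧
  HasTimeDeriv (fun t => (v t : TDist n)) vt ∧
  (∃ vtt : ℝ → TDist n, HasTimeDeriv vt vtt ∧
    ∀ t : ℝ, 0 ≤ t → vtt t - Δ (v t : TDist n) - (a : ℂ) • Δ (vt t) = f t) ∧
  (v 0 : TDist n) = v₀ ∧ vt 0 = v₁

open Classical in
/-- The Laplacian of an `L²` function whose distributional Laplacian is again in `L²`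
(as it is for every function in `H²`, see `coe_l2Laplacian`); `0` otherwise. -/
def l2Laplacian {n : ℕ} (f : L2Space n) : L2Space n :=
  if h : ∃ g : L2Space n, Δ (f : TDist n) = (g : TDist n) then h.choose else 0

theorem coe_l2Laplacian {n : ℕ} (f : L2Space n)
    (hf : TemperedDistribution.MemSobolev 2 2 (f : TDist n)) :
    (l2Laplacian f : TDist n) = Δ (f : TDist n) := by
  have h : ∃ g : L2Space n, Δ (f : TDist n) = (g : TDist n) := by
    have h0 := hf.laplacian
    rw [sub_self] at h0
    exact TemperedDistribution.memSobolev_zero_iff.1 h0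
  rw [l2Laplacian, dif_pos h]
  exact h.choose_spec.symm

/-- The heat layer: the solution of `∂ₜ u = κ Δ u`, `u(0) = (γ - 1) J`, given by the heat kernel. -/
def heatLayer {n : ℕ} (γ κ : ℝ) (J : EuclideanSpace ℝ (Fin n) → ℂ) (t : ℝ)
    (x : EuclideanSpace ℝ (Fin n)) : ℂ :=
  if t = 0 then ((γ - 1 : ℝ) : ℂ) * J x
  else (((γ - 1) / (4 * Real.pi * κ * t) ^ ((n : ℝ) / 2) : ℝ) : ℂ) *
    ∫ y, ((Real.exp (-‖x - y‖ ^ 2 / (4 * κ * t)) : ℝ) : ℂ) * J y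

/-- The norm `‖f‖_{H^s} = ‖⟨D⟩^s f‖_{L²}` as an extended nonnegative number, computed on the Fourier
side; `2 π ξ` appears because Mathlib's Fourier transform uses the phase `e^{-2 π i x·ξ}`. -/
def sobolevENorm {n : ℕ} (s : ℝ) (f : L2Space n) : ℝ≥0∞ :=
  eLpNorm (fun ξ : EuclideanSpace ℝ (Fin n) =>
    (((1 + (2 * Real.pi * ‖ξ‖) ^ 2) ^ (s / 2) : ℝ) : ℂ) * (𝓕 f : L2Space n) ξ) 2 volume

/-- The norm of `H^s ∩ L¹`. -/
def sobolevL1ENorm {n : ℕ} (s : ℝ) (f : L2Space n) : ℝ≥0∞ :=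
  sobolevENorm s f + eLpNorm f 1 volume

end

/-! On the Fourier side the problem decouples into scalar modes. With a = bν and r = 2π|ξ|, the
Blackstock equation becomes u''' + (a+γκ)r²u'' + (r²+γaκr⁴)u' + κr⁴u = 0, and the two viscoelastic
problems become oscillators with damping ar² and stiffness r². For mode data (α, β) put J = β +
ar²α. The core is a bound uniform in t and r, r·|error| ≤ Cκ√κ(1+r²)²(r|α| + |J|), which is
`exists_mode_error_bound`.

If κr² is small, the cubic has a real root -l with l ≈ κr² (`exists_slow_root`). Its contribution to
u is σe^{-lt} with σ ≈ κ(γ-1)J (`slow_amplitude_bound`), which is the heat layer. The rest of u,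
minus z and κw, solves a damped oscillator: its O(κ) forcing is cancelled by the source of w and its
O(κ) datum by w(0), so a Lyapunov estimate (`damped_oscillator_bound`) leaves O(κ²). If κr² is
bounded below, no cancellation is needed: u is controlled by an energy uniform in κ
(`IsModeSystem.energy_bound`), the other terms directly, and 1 ≲ κ^{3/2}r³ supplies the smallness.
The loss from κ² to κ√κ comes from this range, given the weight (1+r²)².

Dividing by r leaves the weight (1+r²)^{5/2} on ψ₀, and (1+r²)^{3/2} plus a singularity r⁻¹ at low
frequency on ψ₁. The singularity is locally square integrable for n ≥ 3, and it is paid for by the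
L¹ norm, which bounds 𝓕ψ₁ pointwise (`eLpNorm_two_multiplier_le`).

The solutions are arbitrary distributional ones, so identifying them with modes is a uniqueness
statement. The difference is tested against compactly supported functions of frequency. Each
Laplacian multiplies the test function by -r², which produces an infinite hierarchy of scalar
equations with geometric bounds, and Picard iteration forces it to vanish (`hierarchy_eq_zero`). -/

noncomputable section

/-! ### Lyapunov estimate for a damped oscillator -/

/-- A function with `H' ≤ -c H + c K` on `[0, ∞)` is bounded by `|H 0| + K`. -/
theorem le_add_of_deriv_le_neg_mul {H H' : ℝ → ℝ} {c K : ℝ} (hc : 0 ≤ c) (hK : 0 ≤ K)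
    (hH0 : 0 ≤ H 0) (hH : ∀ t, 0 ≤ t → HasDerivAt H (H' t) t)
    (hle : ∀ t, 0 ≤ t → H' t ≤ -c * H t + c * K) (t : ℝ) (ht : 0 ≤ t) : H t ≤ H 0 + K := by
  have hd : ∀ t, 0 ≤ t → HasDerivAt (fun t => Real.exp (c * t) * (H t - K))
      (Real.exp (c * t) * (c * 1) * (H t - K) + Real.exp (c * t) * H' t) t := fun t ht =>
    (((hasDerivAt_id t).const_mul c).exp).mul ((hH t ht).sub_const K)
  have hanti : AntitoneOn (fun t => Real.exp (c * t) * (H t - K)) (Ici 0) := by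
    apply antitoneOn_of_hasDerivWithinAt_nonpos (convex_Ici 0)
    · intro x hx
      exact (hd x hx).continuousAt.continuousWithinAt
    · intro x hx
      rw [interior_Ici] at hx
      exact (hd x (le_of_lt hx)).hasDerivWithinAt
    · intro x hx
      rw [interior_Ici] at hx
      have h1 := hle x (le_of_lt hx)
      have h2 := Real.exp_pos (c * x)
      nlinarith
  have h := hanti (by simp : (0 : ℝ) ∈ Ici 0) ht ht
  simp only [mul_zero, Real.exp_zero, one_mul] at h
  have he : 1 ≤ Real.exp (c * t) := Real.one_le_exp (by positivity)
  by_contra hcon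
  push Not at hcon
  nlinarith

/-- Exponential decay for the damped oscillator `v' = y - p v`, `y' = -q v + F`. -/
theorem damped_oscillator_bound {p q η μ r Φ : ℝ} {v y F : ℝ → ℝ} (hp : 0 < p) (hη : 0 < η)
    (hr : 0 < r) (hΦ : 0 ≤ Φ) (hrq : r ^ 2 ≤ q) (hqr : q ≤ 2 * r ^ 2) (h1 : 4 * η ≤ p)
    (h2 : 2 * p * η ≤ q) (hμ : 8 * μ ≤ η)
    (hv : ∀ t, 0 ≤ t → HasDerivAt v (y t - p * v t) t)
    (hy : ∀ t, 0 ≤ t → HasDerivAt y (-q * v t + F t) t)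
    (hF : ∀ t, 0 ≤ t → |F t| ≤ Φ * Real.exp (-μ * t)) (t : ℝ) (ht : 0 ≤ t) :
    r * |v t| ≤ 7 * (2 * r * |v 0| + |y 0| + Φ / η) * Real.exp (-μ * t) ∧
      |y t| ≤ 7 * (2 * r * |v 0| + |y 0| + Φ / η) * Real.exp (-μ * t) := by
  have hq : 0 < q := by nlinarith
  have hη2 : 8 * η ^ 2 ≤ q := by nlinarith
  have key : ∀ V Y : ℝ, (2 * η * V * Y) ≤ (q * V ^ 2 + Y ^ 2) / 2 ∧
      -(2 * η * V * Y) ≤ (q * V ^ 2 + Y ^ 2) / 2 := fun V Y => by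
    constructor <;> nlinarith [sq_nonneg (2 * η * V - Y), sq_nonneg (2 * η * V + Y), sq_nonneg V]
  -- The plain energy qv² + y² dissipates only v². The cross term adds -2ηy², which makes the decay
  -- exponential, and by `key` it is at most half of the energy.
  set W : ℝ → ℝ := fun t => q * v t ^ 2 + y t ^ 2 - 2 * η * v t * y t with hW
  set E2 : ℝ → ℝ := fun t => Real.exp (2 * μ * t)
  have hWd : ∀ t, 0 ≤ t → HasDerivAt W (2 * q * v t * (y t - p * v t)
      + 2 * y t * (-q * v t + F t) - 2 * η * ((y t - p * v t) * y t + v t * (-q * v t + F t))) t := by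
    intro t ht
    have := (((hv t ht).pow 2).const_mul q).add ((hy t ht).pow 2) |>.sub
      (((hv t ht).mul (hy t ht)).const_mul (2 * η))
    convert! this using 1
    · ext x; simp [hW]; ring
    · simp; ring
  have hHd : ∀ t, 0 ≤ t → HasDerivAt (fun t => E2 t * W t) (E2 t * (2 * μ * 1) * W t + E2 t *
      (2 * q * v t * (y t - p * v t)
      + 2 * y t * (-q * v t + F t) - 2 * η * ((y t - p * v t) * y t + v t * (-q * v t + F t)))) t :=
    fun t ht => (((hasDerivAt_id t).const_mul (2 * μ)).exp).mul (hWd t ht)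
  have hW0 : ∀ t, 0 ≤ W t := fun t => by
    have := (key (v t) (y t)).1
    simp only [hW]
    nlinarith [sq_nonneg (v t), sq_nonneg (y t)]
  have hWle : ∀ t, W t ≤ 3 / 2 * (q * v t ^ 2 + y t ^ 2) := fun t => by
    have := (key (v t) (y t)).2
    simp only [hW]
    linarith
  have hleW : ∀ t, (q * v t ^ 2 + y t ^ 2) ≤ 2 * W t := fun t => by
    have := (key (v t) (y t)).1
    simp only [hW]
    linarith
  -- The weight e^{2μt} costs 2μ ≤ η/4 out of the decay rate η/2. With the source 5Φ²/η, the
  -- remaining rate η/4 gives K = 20Φ²/η².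
  have hmain := le_add_of_deriv_le_neg_mul (H := fun t => E2 t * W t) (c := η / 4) (K := 20 * Φ ^ 2 / η ^ 2) (by positivity)
    (by positivity) (mul_nonneg (Real.exp_pos _).le (hW0 0)) hHd (by
      intro t ht
      have hE : 0 < E2 t := Real.exp_pos _
      have hEF : E2 t * F t ^ 2 ≤ Φ ^ 2 := by
        have h3 : F t ^ 2 ≤ (Φ * Real.exp (-μ * t)) ^ 2 := by
          rw [← sq_abs]
          exact pow_le_pow_left₀ (abs_nonneg _) (hF t ht) 2
        have h4 : E2 t * Real.exp (-μ * t) ^ 2 = 1 := by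
          rw [← Real.exp_nat_mul, ← Real.exp_add]
          simp; ring
        calc E2 t * F t ^ 2 ≤ E2 t * (Φ * Real.exp (-μ * t)) ^ 2 := by gcongr
          _ = Φ ^ 2 * (E2 t * Real.exp (-μ * t) ^ 2) := by ring
          _ = Φ ^ 2 := by rw [h4, mul_one]
      have hWd' : 2 * q * v t * (y t - p * v t) + 2 * y t * (-q * v t + F t)
          - 2 * η * ((y t - p * v t) * y t + v t * (-q * v t + F t))
          ≤ -(η / 2) * W t + 5 * (F t ^ 2 / η) := by
        have e1 : 2 * y t * F t ≤ η / 4 * y t ^ 2 + 4 * (F t ^ 2 / η) := by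
          have : η / 4 * y t ^ 2 + 4 * (F t ^ 2 / η) - 2 * y t * F t
              = (η * y t - 4 * F t) ^ 2 / (4 * η) := by field_simp; ring
          have h5 : 0 ≤ (η * y t - 4 * F t) ^ 2 / (4 * η) := by positivity
          linarith
        have e2 : -(2 * η * v t * F t) ≤ 2 * η * (η * v t) ^ 2 + F t ^ 2 / η := by
          have : 2 * η * (η * v t) ^ 2 + F t ^ 2 / η - -(2 * η * v t * F t)
              = (η * (η * v t)) ^ 2 / η + (η * (η * v t) + F t) ^ 2 / η := by field_simp; ring
          have h5 : 0 ≤ (η * (η * v t)) ^ 2 / η + (η * (η * v t) + F t) ^ 2 / η := by positivity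
          linarith
        -- Young's inequality leaves 2ηp²v², which 2pη ≤ q turns into pqv², half of the available
        -- dissipation of v².
        have e3 : 2 * η * p * (v t * y t) ≤ η / 2 * y t ^ 2 + p * q * v t ^ 2 := by
          nlinarith [mul_nonneg hη.le (sq_nonneg (y t - 2 * p * v t)),
            mul_nonneg hp.le (mul_nonneg (sub_nonneg.2 h2) (sq_nonneg (v t)))]
        have e4 : 2 * η * (η * v t) ^ 2 ≤ η / 4 * (q * v t ^ 2) := by
          nlinarith [mul_nonneg hη.le (mul_nonneg (sub_nonneg.2 hη2) (sq_nonneg (v t)))]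
        have e5 : 4 * η * (q * v t ^ 2) ≤ p * (q * v t ^ 2) := by
          have : 0 ≤ q * v t ^ 2 := by positivity
          exact mul_le_mul_of_nonneg_right h1 this
        have e6 := mul_le_mul_of_nonneg_left (hWle t) (half_pos hη).le
        have e7 : 0 ≤ η * (q * v t ^ 2) := by positivity
        have e8 : 0 ≤ η * y t ^ 2 := by positivity
        nlinarith
      have h6 : E2 t * (F t ^ 2 / η) ≤ Φ ^ 2 / η := by
        rw [← mul_div_assoc]; gcongr
      have h7 : η / 4 * (20 * Φ ^ 2 / η ^ 2) = 5 * (Φ ^ 2 / η) := by field_simp; ring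
      rw [h7]
      have h8 := mul_le_mul_of_nonneg_left hWd' hE.le
      have h9 : 0 ≤ (η - 8 * μ) * (E2 t * W t) :=
        mul_nonneg (by linarith) (mul_nonneg hE.le (hW0 t))
      nlinarith) t ht
  set N := 2 * r * |v 0| + |y 0| + Φ / η with hN
  have hN0 : 0 ≤ N := by positivity
  set e := Real.exp (-μ * t) with he
  have he0 : 0 < e := Real.exp_pos _
  have hE : E2 t * e ^ 2 = 1 := by
    rw [he, ← Real.exp_nat_mul, ← Real.exp_add]
    simp; ring
  have hE0 : E2 0 = 1 := by simp [E2]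
  -- Origin of the factor 7: twice 3/2 gives 3, twice 20 gives 40, and both are below 49.
  have h49 : 2 * (W 0 + 20 * Φ ^ 2 / η ^ 2) ≤ (7 * N) ^ 2 := by
    have a1 : q * v 0 ^ 2 ≤ (2 * r * |v 0|) ^ 2 := by
      have : (2 * r * |v 0|) ^ 2 = 4 * r ^ 2 * v 0 ^ 2 := by rw [mul_pow, sq_abs]; ring
      rw [this]
      have h5 := mul_nonneg (sub_nonneg.2 hqr) (sq_nonneg (v 0))
      have h6 := mul_nonneg (sq_nonneg r) (sq_nonneg (v 0))
      linarith
    have a2 : y 0 ^ 2 = |y 0| ^ 2 := (sq_abs _).symm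
    have a3 : 20 * Φ ^ 2 / η ^ 2 = 20 * (Φ / η) ^ 2 := by field_simp
    have a4 := hWle 0
    have b0 : ∀ A B D : ℝ, 0 ≤ A → 0 ≤ B → 0 ≤ D →
        3 * (A ^ 2 + B ^ 2) + 40 * D ^ 2 ≤ (7 * (A + B + D)) ^ 2 := by
      intro A B D hA hB hD
      have : (7 * (A + B + D)) ^ 2 - (3 * (A ^ 2 + B ^ 2) + 40 * D ^ 2)
          = 46 * A ^ 2 + 46 * B ^ 2 + 9 * D ^ 2 + 98 * (A * B + A * D + B * D) := by ring
      have : 0 ≤ 46 * A ^ 2 + 46 * B ^ 2 + 9 * D ^ 2 + 98 * (A * B + A * D + B * D) := by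
        positivity
      linarith
    have b1 := b0 (2 * r * |v 0|) |y 0| (Φ / η) (by positivity) (by positivity) (by positivity)
    rw [a3, hN]
    linarith
  have hfin : q * v t ^ 2 + y t ^ 2 ≤ (7 * N * e) ^ 2 := by
    rw [hE0, one_mul] at hmain
    calc q * v t ^ 2 + y t ^ 2 ≤ 2 * W t := hleW t
      _ = 2 * (E2 t * W t) * e ^ 2 := by linear_combination (-2 * W t) * hE
      _ ≤ (7 * N) ^ 2 * e ^ 2 := by
        apply mul_le_mul_of_nonneg_right _ (sq_nonneg e)
        linarith
      _ = (7 * N * e) ^ 2 := by ring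
  have hpos : 0 ≤ 7 * N * e := by positivity
  constructor
  · rw [← abs_of_pos hr, ← abs_mul]
    apply abs_le_of_sq_le_sq _ hpos
    have h5 := mul_nonneg (sub_nonneg.2 hrq) (sq_nonneg (v t))
    have h6 := sq_nonneg (y t)
    rw [mul_pow]
    linarith
  · apply abs_le_of_sq_le_sq _ hpos
    have h5 := mul_nonneg hq.le (sq_nonneg (v t))
    linarith

/-! ### Decay of the viscoelastic modes -/

/-- The decay rate of the viscoelastic modes at frequency `r`. -/
def modeRate (K r : ℝ) : ℝ := r ^ 2 / (4 * K * (1 + r ^ 2))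

theorem modeRate_pos {K r : ℝ} (hK : 1 ≤ K) (hr : 0 < r) : 0 < modeRate K r := by
  unfold modeRate; positivity

/-- The small-frequency constraint: there the rate is comparable to r², just as the damping ar² is.
-/
theorem four_mul_modeRate_le {a K r : ℝ} (hK : 1 ≤ K) (haK : 1 ≤ a * K) :
    4 * modeRate K r ≤ a * r ^ 2 := by
  have h : 4 * modeRate K r = r ^ 2 / (K * (1 + r ^ 2)) := by
    unfold modeRate; field_simp
  rw [h, div_le_iff₀ (by positivity)]
  have h2 : 1 ≤ a * K * (1 + r ^ 2) := by nlinarith [sq_nonneg r]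
  calc r ^ 2 = r ^ 2 * 1 := by ring
    _ ≤ r ^ 2 * (a * K * (1 + r ^ 2)) := by gcongr
    _ = _ := by ring

/-- The large-frequency constraint: an overdamped oscillator decays no faster than about q/p, which
stays bounded when p is of order r². The denominator 1 + r² in `modeRate` accounts for this. -/
theorem two_mul_mul_modeRate_le {a K r p : ℝ} (hK : 1 ≤ K) (haK : a ≤ K) (hp : p ≤ 2 * a * r ^ 2) :
    2 * p * modeRate K r ≤ r ^ 2 := by
  have h : 2 * p * modeRate K r = 2 * p * r ^ 2 / (4 * K * (1 + r ^ 2)) := by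
    unfold modeRate; ring
  rw [h, div_le_iff₀ (by positivity)]
  have h2 : 2 * p ≤ 4 * K * (1 + r ^ 2) := by nlinarith [sq_nonneg r]
  calc 2 * p * r ^ 2 ≤ 4 * K * (1 + r ^ 2) * r ^ 2 := by gcongr
    _ = _ := by ring

/-- The rate vanishes like r² at low frequency, but every forcing below carries a factor r², so the
quotient Φ/η stays bounded there. -/
theorem div_modeRate {K r : ℝ} (hK : 1 ≤ K) (hr : 0 < r) (x : ℝ) :
    r ^ 2 * x / modeRate K r = 4 * K * (1 + r ^ 2) * x := by
  unfold modeRate; field_simp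

/-- Bound for the mode of the free viscoelastic equation. -/
theorem free_mode_bound {a K r : ℝ} {z z1 : ℝ → ℝ} (ha : 0 < a) (hK : 1 ≤ K) (haK : a ≤ K)
    (haK' : 1 ≤ a * K) (hr : 0 < r)
    (hz : ∀ t, HasDerivAt z (z1 t) t)
    (hz1 : ∀ t, HasDerivAt z1 (-r ^ 2 * z t - a * r ^ 2 * z1 t) t) (t : ℝ) (ht : 0 ≤ t) :
    r * |z t| ≤ 14 * (r * |z 0| + |z1 0 + a * r ^ 2 * z 0|) *
        Real.exp (-(modeRate K r / 8) * t) ∧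
      |z1 t + a * r ^ 2 * z t| ≤ 14 * (r * |z 0| + |z1 0 + a * r ^ 2 * z 0|) *
        Real.exp (-(modeRate K r / 8) * t) := by
  have h := damped_oscillator_bound (p := a * r ^ 2) (q := r ^ 2) (η := modeRate K r)
    (μ := modeRate K r / 8) (r := r) (Φ := 0) (v := z) (y := fun t => z1 t + a * r ^ 2 * z t)
    (F := fun _ => 0)
    (by positivity) (modeRate_pos hK hr) hr le_rfl le_rfl (by nlinarith [sq_nonneg r])
    (four_mul_modeRate_le hK haK') (two_mul_mul_modeRate_le hK haK (by nlinarith [sq_nonneg r]))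
    (by linarith) (fun t _ => by convert! hz t using 1; ring)
    (fun t _ => by convert! (hz1 t).add ((hz t).const_mul (a * r ^ 2)) using 1; ring)
    (fun t _ => by simp) t ht
  have hle : 7 * (2 * r * |z 0| + |z1 0 + a * r ^ 2 * z 0| + 0 / modeRate K r) ≤
      14 * (r * |z 0| + |z1 0 + a * r ^ 2 * z 0|) := by
    rw [zero_div]
    linarith [abs_nonneg (z1 0 + a * r ^ 2 * z 0)]
  exact ⟨h.1.trans (by gcongr), h.2.trans (by gcongr)⟩

/-- Bound for the mode of the first corrector. -/
theorem corrector_mode_bound {a K r g A : ℝ} {z z1 w w1 : ℝ → ℝ} (ha : 0 < a) (hK : 1 ≤ K)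
    (haK : a ≤ K) (haK' : 1 ≤ a * K) (hr : 0 < r) (hg : 0 ≤ g) (hg1 : g ≤ 1)
    (hA : A = r * |z 0| + |z1 0 + a * r ^ 2 * z 0|)
    (hz : ∀ t, HasDerivAt z (z1 t) t)
    (hz1 : ∀ t, HasDerivAt z1 (-r ^ 2 * z t - a * r ^ 2 * z1 t) t)
    (hw : ∀ t, HasDerivAt w (w1 t) t)
    (hw1 : ∀ t, HasDerivAt w1 (-r ^ 2 * w t - a * r ^ 2 * w1 t
      - g * r ^ 2 * (z1 t + a * r ^ 2 * z t)) t)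
    (hw0 : w 0 = -g * (z1 0 + a * r ^ 2 * z 0)) (hw10 : w1 0 = 0) (t : ℝ) (ht : 0 ≤ t) :
    r * |w t| ≤ 420 * K * (1 + r ^ 2) * A * Real.exp (-(modeRate K r / 8) * t) ∧
      |w1 t + a * r ^ 2 * w t| ≤ 420 * K * (1 + r ^ 2) * A *
        Real.exp (-(modeRate K r / 8) * t) := by
  have hA0 : 0 ≤ A := by rw [hA]; positivity
  have hJA : |z1 0 + a * r ^ 2 * z 0| ≤ A := by
    rw [hA]; linarith [mul_nonneg hr.le (abs_nonneg (z 0))]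
  -- The forcing is the free mode, already known to decay at an eighth of `modeRate`, so the
  -- response may be given the same exponential.
  have h := damped_oscillator_bound (p := a * r ^ 2) (q := r ^ 2) (η := modeRate K r)
    (μ := modeRate K r / 8) (r := r) (Φ := r ^ 2 * (14 * A)) (v := w)
    (y := fun t => w1 t + a * r ^ 2 * w t) (F := fun t => -(g * r ^ 2 * (z1 t + a * r ^ 2 * z t)))
    (by positivity) (modeRate_pos hK hr) hr (by positivity) le_rfl (by nlinarith [sq_nonneg r])
    (four_mul_modeRate_le hK haK') (two_mul_mul_modeRate_le hK haK (by nlinarith [sq_nonneg r]))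
    (by linarith) (fun t _ => by convert! hw t using 1; ring)
    (fun t _ => by convert! (hw1 t).add ((hw t).const_mul (a * r ^ 2)) using 1; ring)
    (fun t ht => by
      have h1 := (free_mode_bound ha hK haK haK' hr hz hz1 t ht).2
      rw [← hA] at h1
      rw [abs_neg, abs_mul, abs_of_nonneg (by positivity : 0 ≤ g * r ^ 2)]
      calc g * r ^ 2 * |z1 t + a * r ^ 2 * z t| ≤
          1 * r ^ 2 * (14 * A * Real.exp (-(modeRate K r / 8) * t)) := by gcongr
        _ = _ := by ring) t ht
  have hle : 7 * (2 * r * |w 0| + |w1 0 + a * r ^ 2 * w 0| + r ^ 2 * (14 * A) / modeRate K r) ≤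
      420 * K * (1 + r ^ 2) * A := by
    rw [div_modeRate hK hr, hw10, zero_add, abs_mul, abs_of_pos (by positivity : 0 < a * r ^ 2)]
    have h1 : |w 0| ≤ A := by
      rw [hw0, abs_mul, abs_neg, abs_of_nonneg hg]
      calc g * |z1 0 + a * r ^ 2 * z 0| ≤ 1 * A := by gcongr
        _ = A := one_mul A
    have h2 : 2 * r * |w 0| ≤ (1 + r ^ 2) * A := by
      have : 2 * r ≤ 1 + r ^ 2 := by nlinarith [sq_nonneg (r - 1)]
      gcongr
    have h3 : (1 + r ^ 2) * A ≤ K * ((1 + r ^ 2) * A) := le_mul_of_one_le_left (by positivity) hK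
    have h4 : a * r ^ 2 * |w 0| ≤ K * (1 + r ^ 2) * A := by
      have : r ^ 2 ≤ 1 + r ^ 2 := by linarith
      gcongr
    have h5 : 0 ≤ K * (1 + r ^ 2) * A := by positivity
    linarith
  exact ⟨h.1.trans (by gcongr), h.2.trans (by gcongr)⟩

/-! ### The slow characteristic root and its amplitude -/

/-- For small `κ r²` the characteristic cubic of the Blackstock equation has a real root `-l` with
`l` close to `κ r²`. -/
theorem exists_slow_root {a γ κ r : ℝ} (ha : 0 < a) (hγ : 1 ≤ γ) (hκ : 0 < κ) (hκa : κ ≤ a)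
    (hr : 0 < r) (hX : γ * a * (κ * r ^ 2) ≤ 1 / 2) :
    ∃ l : ℝ, κ * r ^ 2 / 2 ≤ l ∧ l ≤ κ * r ^ 2 ∧
      κ * r ^ 2 - l ≤ γ * a * (κ * r ^ 2) ^ 2 ∧
      l ^ 3 - (a + γ * κ) * r ^ 2 * l ^ 2 + (r ^ 2 + γ * a * κ * r ^ 4) * l - κ * r ^ 4 = 0 := by
  set X := κ * r ^ 2 with hXd
  have hX0 : 0 < X := by positivity
  -- This is the cubic at l = Xm divided by -κr⁴. Its signs at m = 1/2 and m = 1 differ weakly, so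
  -- the intermediate value theorem gives the root.
  set c : ℝ → ℝ := fun m => -κ * X * m ^ 3 + (a + γ * κ) * X * m ^ 2 - (1 + γ * a * X) * m + 1
  have hc : ContinuousOn c (Icc (1 / 2) 1) := by fun_prop
  have h1 : c 1 ≤ 0 := by
    have : c 1 = -((γ - 1) * X * (a - κ)) := by simp only [c]; ring
    rw [this, neg_nonpos]
    exact mul_nonneg (mul_nonneg (by linarith) hX0.le) (by linarith)
  have h2 : 0 ≤ c (1 / 2) := by
    have : c (1 / 2) = (1 / 2 - γ * a * X) / 2 + 1 / 4 + X * a / 4 + X * κ * (2 * γ - 1) / 8 := by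
      simp only [c]; ring
    rw [this]
    have h3 : 0 ≤ X * κ * (2 * γ - 1) := by
      apply mul_nonneg (by positivity); linarith
    have h4 : 0 ≤ X * a := by positivity
    linarith
  obtain ⟨m, ⟨hm1, hm2⟩, hm⟩ := intermediate_value_Icc' (by norm_num) hc ⟨h1, h2⟩
  have hm0 : 0 < m := by linarith
  simp only [c] at hm
  refine ⟨X * m, by nlinarith, by nlinarith, ?_, ?_⟩
  -- The equation c(m) = 0 reads 1 - m = γaXm - X((a+γκ)m² - κm³), and the last bracket is
  -- nonnegative.
  · have h5 : 1 - m ≤ γ * a * X := by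
      have h6 : κ * m ^ 3 ≤ (a + γ * κ) * m ^ 2 := by
        have : κ * m ^ 3 ≤ κ * m ^ 2 := by
          gcongr 1
          exact pow_le_pow_of_le_one hm0.le hm2 (by norm_num)
        have h7 : 0 ≤ (a + (γ - 1) * κ) * m ^ 2 := by
          apply mul_nonneg _ (sq_nonneg m)
          nlinarith
        linarith
      have h8 := mul_le_mul_of_nonneg_left h6 hX0.le
      have h9 : γ * a * X * m ≤ γ * a * X * 1 := by gcongr
      linarith
    calc X - X * m = X * (1 - m) := by ring
      _ ≤ X * (γ * a * X) := by gcongr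
      _ = _ := by ring
  · rw [hXd] at hm ⊢
    linear_combination (-κ * r ^ 4) * hm

theorem eq_mul_exp_of_hasDerivAt {f : ℝ → ℝ} {l : ℝ} (hf : ∀ t, HasDerivAt f (-l * f t) t)
    (t : ℝ) : f t = f 0 * Real.exp (-l * t) := by
  have hd : ∀ t, HasDerivAt (fun t => f t * Real.exp (l * t)) 0 t := fun t => by
    convert! (hf t).mul (((hasDerivAt_id t).const_mul l).exp) using 1
    simp; ring
  have h := is_const_of_deriv_eq_zero (fun t => (hd t).differentiableAt)
    (fun t => (hd t).deriv) t 0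
  simp only [mul_zero, Real.exp_zero, mul_one] at h
  rw [← h, mul_assoc, ← Real.exp_add]
  simp

/-- The difference is at most (X-l)·t·e^{-lt}, and te^{-lt} ≤ 1/l uniformly in time. Replacing the
exact slow exponent by κr² therefore costs only a relative error. -/
theorem abs_exp_sub_exp_le {l X t : ℝ} (hl : 0 < l) (hlX : l ≤ X) (ht : 0 ≤ t) :
    |Real.exp (-l * t) - Real.exp (-X * t)| ≤ (X - l) / l := by
  have h1 : Real.exp (-X * t) ≤ Real.exp (-l * t) := Real.exp_le_exp.2 (by nlinarith)
  rw [abs_of_nonneg (by linarith)]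
  have h2 : Real.exp (-X * t) = Real.exp (-l * t) * Real.exp (-((X - l) * t)) := by
    rw [← Real.exp_add]; ring_nf
  have h3 : 1 - (X - l) * t ≤ Real.exp (-((X - l) * t)) := by
    linarith [Real.add_one_le_exp (-((X - l) * t))]
  have h4 : Real.exp (-l * t) * (l * t) ≤ 1 := by
    have h5 : l * t ≤ Real.exp (l * t) := by linarith [Real.add_one_le_exp (l * t)]
    calc Real.exp (-l * t) * (l * t) ≤ Real.exp (-l * t) * Real.exp (l * t) := by gcongr
      _ = 1 := by rw [← Real.exp_add]; simp
  have h6 : 0 < Real.exp (-l * t) := Real.exp_pos _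
  rw [h2, le_div_iff₀ hl]
  calc (Real.exp (-l * t) - Real.exp (-l * t) * Real.exp (-((X - l) * t))) * l
      = Real.exp (-l * t) * (1 - Real.exp (-((X - l) * t))) * l := by ring
    _ ≤ Real.exp (-l * t) * ((X - l) * t) * l := by gcongr; linarith
    _ = (X - l) * (Real.exp (-l * t) * (l * t)) := by ring
    _ ≤ (X - l) * 1 := by
      apply mul_le_mul_of_nonneg_left h4; linarith
    _ = X - l := mul_one _

/-- The amplitude `g (J - l α) / d` of the slow mode is `κ (γ - 1) J` up to higher order. -/
theorem slow_amplitude_bound {a K γ κ r l X α J : ℝ} (ha : 0 < a) (hK : 1 ≤ K) (haK : a ≤ K)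
    (hγ : 1 ≤ γ) (hγ' : γ ≤ 2) (hκ : 0 < κ) (hκ1 : κ ≤ 1) (hr : 0 < r) (hX : X = κ * r ^ 2)
    (hXK : 14 * K * X ≤ 1) (hl : X / 2 ≤ l) (hlX : l ≤ X) (he : X - l ≤ 2 * K * X ^ 2) :
    0 < l ^ 2 - ((a + γ * κ) * r ^ 2 - l) * l
        + (r ^ 2 + (γ * X - l) * (a * r ^ 2 - l)) ∧
      |(γ * X - l) * (J - l * α) / (l ^ 2 - ((a + γ * κ) * r ^ 2 - l) * l
        + (r ^ 2 + (γ * X - l) * (a * r ^ 2 - l))) - κ * (γ - 1) * J|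
      ≤ 18 * K * (κ * X * (|J| + |α|)) := by
  set d := l ^ 2 - ((a + γ * κ) * r ^ 2 - l) * l + (r ^ 2 + (γ * X - l) * (a * r ^ 2 - l)) with hd
  have hX0 : 0 < X := by rw [hX]; positivity
  have hl0 : 0 < l := by linarith
  set g := γ * X - l with hg
  have hg0 : 0 ≤ g := by rw [hg]; nlinarith
  have hg2 : g ≤ 2 * X := by rw [hg]; nlinarith
  -- The number d is the quadratic factor of the cubic evaluated at -l. It equals r² up to a
  -- relative error of order X, and 14KX ≤ 1 keeps at least half of r².
  have hdr : d - r ^ 2 = a * r ^ 2 * (g - l) + (l ^ 2 - 2 * g * l) := by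
    rw [hd, hg, hX]; ring
  have hdr' : |d - r ^ 2| ≤ 7 * K * (X * r ^ 2) := by
    rw [hdr]
    have h1 : |g - l| ≤ 2 * X := abs_le.2 ⟨by linarith, by linarith⟩
    have h2 : |l ^ 2 - 2 * g * l| ≤ 5 * X ^ 2 := by
      have h3 : 0 ≤ g * l := by positivity
      have h4 : g * l ≤ 2 * X * X := by gcongr
      have h5 : l ^ 2 ≤ X ^ 2 := by gcongr
      exact abs_le.2 ⟨by nlinarith, by nlinarith⟩
    have h6 : X ^ 2 ≤ X * r ^ 2 := by
      rw [sq, hX]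
      gcongr
      nlinarith [sq_nonneg r]
    calc |a * r ^ 2 * (g - l) + (l ^ 2 - 2 * g * l)|
        ≤ |a * r ^ 2 * (g - l)| + |l ^ 2 - 2 * g * l| := abs_add_le _ _
      _ ≤ K * r ^ 2 * (2 * X) + 5 * (X * r ^ 2) := by
        rw [abs_mul, abs_of_pos (by positivity : 0 < a * r ^ 2)]
        gcongr
        linarith
      _ ≤ _ := by
        have : 0 ≤ (K - 1) * (X * r ^ 2) := mul_nonneg (by linarith) (by positivity)
        linarith
  have hdpos : r ^ 2 / 2 ≤ d := by
    have h1 := (abs_le.1 hdr').1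
    have h2 : 14 * K * X * r ^ 2 ≤ 1 * r ^ 2 := by gcongr
    linarith
  have hd0 : 0 < d := lt_of_lt_of_le (by positivity) hdpos
  refine ⟨hd0, ?_⟩
  -- Since κ(γ-1)r² = (γ-1)X, the leading part of g cancels and leaves X - l. Every remaining
  -- coefficient is O(X²), and division by d ≥ r²/2 turns X² into κX.
  have hnum : g * (J - l * α) / d - κ * (γ - 1) * J
      = ((X - l - κ * (γ - 1) * (d - r ^ 2)) * J - g * l * α) / d := by
    rw [eq_div_iff hd0.ne', sub_mul, div_mul_cancel₀ _ hd0.ne', hg, hX]; ring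
  rw [hnum, abs_div, abs_of_pos hd0, div_le_iff₀ hd0]
  have h1 : |X - l - κ * (γ - 1) * (d - r ^ 2)| ≤ 9 * K * X ^ 2 := by
    have h2 : |κ * (γ - 1) * (d - r ^ 2)| ≤ κ * 1 * (7 * K * (X * r ^ 2)) := by
      rw [abs_mul, abs_of_nonneg (mul_nonneg hκ.le (by linarith) : 0 ≤ κ * (γ - 1))]
      gcongr
      linarith
    have h3 : κ * 1 * (7 * K * (X * r ^ 2)) = 7 * K * X ^ 2 := by rw [hX]; ring
    rw [h3] at h2
    have h4 := abs_le.1 h2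
    have h5 : 0 ≤ K * X ^ 2 := by positivity
    exact abs_le.2 ⟨by linarith, by linarith⟩
  have h2 : |g * l * α| ≤ 9 * K * X ^ 2 * |α| := by
    rw [abs_mul, abs_of_nonneg (by positivity : 0 ≤ g * l)]
    apply mul_le_mul_of_nonneg_right _ (abs_nonneg α)
    calc g * l ≤ 2 * X * X := by gcongr
      _ ≤ 9 * K * X ^ 2 := by nlinarith [sq_nonneg X]
  calc |(X - l - κ * (γ - 1) * (d - r ^ 2)) * J - g * l * α|
      ≤ |(X - l - κ * (γ - 1) * (d - r ^ 2)) * J| + |g * l * α| := abs_sub _ _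
    _ ≤ 9 * K * X ^ 2 * |J| + 9 * K * X ^ 2 * |α| := by
      rw [abs_mul]
      gcongr
    _ = 18 * K * (κ * X * (|J| + |α|)) * (r ^ 2 / 2) := by rw [hX]; ring
    _ ≤ 18 * K * (κ * X * (|J| + |α|)) * d := by gcongr

/-! ### Error estimate for a single mode -/

/-- A Blackstock mode at frequency `r`, its zeroth-order approximation and the first corrector. -/
structure IsModeSystem (a γ κ r α β : ℝ) (u u1 u2 z z1 w w1 : ℝ → ℝ) : Prop where
  u_deriv : ∀ t, HasDerivAt u (u1 t) t
  u1_deriv : ∀ t, HasDerivAt u1 (u2 t) t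
  u2_deriv : ∀ t, HasDerivAt u2 (-((a + γ * κ) * r ^ 2) * u2 t
    - (r ^ 2 + γ * a * κ * r ^ 4) * u1 t - κ * r ^ 4 * u t) t
  z_deriv : ∀ t, HasDerivAt z (z1 t) t
  z1_deriv : ∀ t, HasDerivAt z1 (-r ^ 2 * z t - a * r ^ 2 * z1 t) t
  w_deriv : ∀ t, HasDerivAt w (w1 t) t
  w1_deriv : ∀ t, HasDerivAt w1 (-r ^ 2 * w t - a * r ^ 2 * w1 t
    - (γ - 1) * r ^ 2 * (z1 t + a * r ^ 2 * z t)) t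
  u_zero : u 0 = α
  u1_zero : u1 0 = β
  u2_zero : u2 0 = -(a * r ^ 2) * β - r ^ 2 * α
  z_zero : z 0 = α
  z1_zero : z1 0 = β
  w_zero : w 0 = (1 - γ) * (β + a * r ^ 2 * α)
  w1_zero : w1 0 = 0

/-- The approximation error of a mode. -/
def modeError (γ κ r J : ℝ) (u z w : ℝ → ℝ) (t : ℝ) : ℝ :=
  u t - (z t + κ * w t + κ * ((γ - 1) * (Real.exp (-(κ * r ^ 2) * t) * J)))

section

variable {a K γ κ r α β A : ℝ} {u u1 u2 z z1 w w1 : ℝ → ℝ}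

theorem IsModeSystem.bounds (h : IsModeSystem a γ κ r α β u u1 u2 z z1 w w1) (ha : 0 < a)
    (hK : 1 ≤ K) (haK : a ≤ K) (haK' : 1 ≤ a * K) (hr : 0 < r) (hγ : 1 ≤ γ) (hγ' : γ ≤ 2)
    (hA : A = r * |α| + |β + a * r ^ 2 * α|) (t : ℝ) (ht : 0 ≤ t) :
    (r * |z t| ≤ 14 * A * Real.exp (-(modeRate K r / 8) * t) ∧
      |z1 t + a * r ^ 2 * z t| ≤ 14 * A * Real.exp (-(modeRate K r / 8) * t)) ∧
    (r * |w t| ≤ 420 * K * (1 + r ^ 2) * A * Real.exp (-(modeRate K r / 8) * t) ∧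
      |w1 t + a * r ^ 2 * w t| ≤ 420 * K * (1 + r ^ 2) * A *
        Real.exp (-(modeRate K r / 8) * t)) := by
  constructor
  · have := free_mode_bound ha hK haK haK' hr h.z_deriv h.z1_deriv t ht
    rwa [h.z_zero, h.z1_zero, ← hA] at this
  · refine corrector_mode_bound (g := γ - 1) ha hK haK haK' hr (by linarith) (by linarith) ?_
      h.z_deriv h.z1_deriv h.w_deriv h.w1_deriv ?_ h.w1_zero t ht
    · rw [h.z_zero, h.z1_zero, hA]
    · rw [h.z_zero, h.z1_zero, h.w_zero]; ring

/-- The energy of the Blackstock equation, written as a hyperbolic-parabolic system, decreases. -/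
theorem IsModeSystem.energy_bound (h : IsModeSystem a γ κ r α β u u1 u2 z z1 w w1) (ha : 0 < a)
    (hκ : 0 < κ) (hr : 0 < r) (hγ : 1 < γ) (hγ' : γ ≤ 2)
    (hA : A = r * |α| + |β + a * r ^ 2 * α|) (t : ℝ) (ht : 0 ≤ t) : r * |u t| ≤ 2 * A := by
  set c := (γ - 1) * κ * r ^ 2 with hc
  have hc0 : 0 < c := by
    have : 0 < γ - 1 := by linarith
    positivity
  set Y : ℝ → ℝ := fun t => u1 t + a * r ^ 2 * u t with hY
  -- First-order form: u' = Y - ar²u, Y' = -r²u - c(Y-T), T' = κr²(Y-T). The division by c, which is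
  -- of order κ, is harmless because the prescribed u''(0) makes T(0) = Y(0).
  set T : ℝ → ℝ := fun t => Y t + (u2 t + a * r ^ 2 * u1 t + r ^ 2 * u t) / c with hT
  have hcT : ∀ t, c * (Y t - T t) = -(u2 t + a * r ^ 2 * u1 t + r ^ 2 * u t) := fun t => by
    simp only [hT]; field_simp; ring
  have hYd : ∀ t, HasDerivAt Y (-r ^ 2 * u t - c * (Y t - T t)) t := fun t => by
    convert! (h.u1_deriv t).add ((h.u_deriv t).const_mul (a * r ^ 2)) using 1
    rw [hcT]; ring
  have hTd : ∀ t, HasDerivAt T (κ * r ^ 2 * (Y t - T t)) t := fun t => by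
    convert! (hYd t).add ((((h.u2_deriv t).add ((h.u1_deriv t).const_mul (a * r ^ 2))).add
      ((h.u_deriv t).const_mul (r ^ 2))).div_const c) using 1
    rw [eq_comm, ← sub_eq_zero]
    have h1 : c * (-r ^ 2 * u t - c * (Y t - T t) + (-((a + γ * κ) * r ^ 2) * u2 t
        - (r ^ 2 + γ * a * κ * r ^ 4) * u1 t - κ * r ^ 4 * u t + a * r ^ 2 * u2 t
        + r ^ 2 * u1 t) / c - κ * r ^ 2 * (Y t - T t)) = 0 := by
      have h2 : ∀ x : ℝ, c * (x / c) = x := fun x => by field_simp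
      rw [mul_sub, mul_add, h2, mul_sub, show c * (κ * r ^ 2 * (Y t - T t))
        = κ * r ^ 2 * (c * (Y t - T t)) by ring, hcT, hc]
      ring
    exact (mul_eq_zero.1 h1).resolve_left hc0.ne'
  -- The weight γ-1 on T² makes the exchange between Y and T contribute exactly -2c(Y-T)².
  set E : ℝ → ℝ := fun t => r ^ 2 * u t ^ 2 + Y t ^ 2 + (γ - 1) * T t ^ 2 with hE
  have hEd : ∀ t, HasDerivAt E (-(2 * a * r ^ 4 * u t ^ 2 + 2 * c * (Y t - T t) ^ 2)) t := by
    intro t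
    have := ((((h.u_deriv t).pow 2).const_mul (r ^ 2)).add ((hYd t).pow 2)).add
      (((hTd t).pow 2).const_mul (γ - 1))
    convert! this using 1
    have : u1 t = Y t - a * r ^ 2 * u t := by simp [hY]
    simp only [Nat.cast_ofNat, Nat.add_one_sub_one, pow_one, this, hc]
    ring
  have hanti : Antitone E := antitone_of_hasDerivAt_nonpos hEd fun t => by
    have : 0 ≤ 2 * a * r ^ 4 * u t ^ 2 + 2 * c * (Y t - T t) ^ 2 := by positivity
    exact neg_nonpos.2 this
  have hle := hanti ht
  have hY0 : Y 0 = β + a * r ^ 2 * α := by simp [hY, h.u_zero, h.u1_zero]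
  have hT0 : T 0 = β + a * r ^ 2 * α := by
    have : u2 0 + a * r ^ 2 * u1 0 + r ^ 2 * u 0 = 0 := by
      rw [h.u_zero, h.u1_zero, h.u2_zero]; ring
    simp only [hT, this, hY0, zero_div, add_zero]
  have hE0 : E 0 ≤ (2 * A) ^ 2 := by
    simp only [hE, hY0, hT0, h.u_zero]
    set J := β + a * r ^ 2 * α
    have e1 : r ^ 2 * α ^ 2 = (r * |α|) ^ 2 := by rw [mul_pow, sq_abs]
    have e2 : J ^ 2 = |J| ^ 2 := (sq_abs J).symm
    have e3 : (γ - 1) * |J| ^ 2 ≤ 1 * |J| ^ 2 := by gcongr; linarith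
    have e4 : 0 ≤ r * |α| * |J| := by positivity
    rw [e1, e2, hA]
    nlinarith [sq_nonneg (r * |α|), sq_nonneg |J|]
  have hA0 : 0 ≤ 2 * A := by rw [hA]; positivity
  rw [← abs_of_pos hr, ← abs_mul]
  apply abs_le_of_sq_le_sq _ hA0
  have h1 : 0 ≤ (γ - 1) * T t ^ 2 := mul_nonneg (by linarith) (sq_nonneg _)
  have h2 : r ^ 2 * u t ^ 2 ≤ E t := by
    simp only [hE]; linarith [sq_nonneg (Y t)]
  rw [mul_pow]
  linarith

/-- The error bound for large `κ r²`. -/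
theorem IsModeSystem.error_bound_high (h : IsModeSystem a γ κ r α β u u1 u2 z z1 w w1)
    (ha : 0 < a) (hK : 1 ≤ K) (haK : a ≤ K) (haK' : 1 ≤ a * K) (hκ : 0 < κ)
    (hκK : 14 * K * κ ≤ 1) (hr : 0 < r) (hγ : 1 < γ) (hγ' : γ ≤ 2)
    (hX : 1 ≤ 14 * K * (κ * r ^ 2))
    (hA : A = r * |α| + |β + a * r ^ 2 * α|) (t : ℝ) (ht : 0 ≤ t) :
    r * |modeError γ κ r (β + a * r ^ 2 * α) u z w t| ≤
      60022 * K ^ 2 * (κ * √κ) * (1 + r ^ 2) ^ 2 * A := by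
  set k := √κ with hk
  have hk0 : 0 < k := Real.sqrt_pos.2 hκ
  have hκk : κ = k ^ 2 := (Real.sq_sqrt hκ.le).symm
  have hA0 : 0 ≤ A := by rw [hA]; positivity
  have hJA : |β + a * r ^ 2 * α| ≤ A := by
    rw [hA]; linarith [mul_nonneg hr.le (abs_nonneg α)]
  have hr1 : 1 ≤ r := by
    have h1 : 14 * K * κ * 1 ≤ 14 * K * κ * r ^ 2 := by linarith
    have h2 : 1 ≤ r ^ 2 := le_of_mul_le_mul_left h1 (by positivity)
    nlinarith
  have hexp : ∀ c : ℝ, 0 ≤ c → Real.exp (-c * t) ≤ 1 := fun c hc =>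
    Real.exp_le_one_iff.2 (by nlinarith)
  obtain ⟨⟨hz, -⟩, ⟨hw, -⟩⟩ := h.bounds ha hK haK haK' hr hγ.le hγ' hA t ht
  have hrate := hexp _ (div_nonneg (modeRate_pos hK hr).le (by norm_num : (0 : ℝ) ≤ 8))
  have hz' : r * |z t| ≤ 14 * A := hz.trans (mul_le_of_le_one_right (by positivity) hrate)
  have hw' : r * |w t| ≤ 420 * K * (1 + r ^ 2) * A :=
    hw.trans (mul_le_of_le_one_right (by positivity) hrate)
  have hu := h.energy_bound ha hκ hr hγ hγ' hA t ht
  have hheat : |(γ - 1) * (Real.exp (-(κ * r ^ 2) * t) * (β + a * r ^ 2 * α))| ≤ A := by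
    rw [abs_mul, abs_mul, abs_of_pos (Real.exp_pos _), abs_of_pos (by linarith : 0 < γ - 1)]
    calc (γ - 1) * (Real.exp (-(κ * r ^ 2) * t) * |β + a * r ^ 2 * α|) ≤ 1 * (1 * A) := by
          gcongr
          · linarith
          · exact hexp _ (by positivity)
      _ = A := by ring
  -- `14 K k r ≥ 1`
  have hkr : 1 ≤ 14 * K * (k * r) := by
    by_contra hcon
    push Not at hcon
    have h1 : (14 * K * (k * r)) * (14 * K * (k * r)) < 1 * 1 := by gcongr
    rw [hκk] at hX
    have h2 : 14 * K * (k ^ 2 * r ^ 2) * 1 ≤ 14 * K * (k ^ 2 * r ^ 2) * (14 * K) := by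
      gcongr; linarith
    nlinarith
  have hr3 : r ^ 3 ≤ (1 + r ^ 2) ^ 2 := by nlinarith [sq_nonneg (r - 1), sq_nonneg r, sq_nonneg (r^2)]
  have hr3' : (1 + r ^ 2) * r ≤ (1 + r ^ 2) ^ 2 := by
    rw [sq (1 + r ^ 2)]; gcongr; nlinarith [sq_nonneg (r - 1)]
  -- M is the target size. A term of order one needs κr²·√κr to reach it; a term already carrying κ
  -- needs only √κr.
  set M := k ^ 3 * (1 + r ^ 2) ^ 2 with hM
  have c1 : 1 ≤ 196 * K ^ 2 * M := by
    calc (1 : ℝ) = 1 * 1 := by ring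
      _ ≤ (14 * K * (κ * r ^ 2)) * (14 * K * (k * r)) := by gcongr
      _ = 196 * K ^ 2 * (k ^ 3 * r ^ 3) := by rw [hκk]; ring
      _ ≤ 196 * K ^ 2 * M := by rw [hM]; gcongr
  have c2 : κ * (1 + r ^ 2) ≤ 14 * K * M := by
    calc κ * (1 + r ^ 2) = κ * (1 + r ^ 2) * 1 := by ring
      _ ≤ κ * (1 + r ^ 2) * (14 * K * (k * r)) := by gcongr
      _ = 14 * K * (k ^ 3 * ((1 + r ^ 2) * r)) := by rw [hκk]; ring
      _ ≤ 14 * K * M := by rw [hM]; gcongr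
  have c3 : κ * r ≤ 14 * K * M := by
    refine le_trans ?_ c2
    gcongr
    nlinarith [sq_nonneg (r - 1)]
  have hM0 : 0 ≤ M := by positivity
  have hKM : K * M ≤ K ^ 2 * M := by
    gcongr; nlinarith
  unfold modeError
  have habs := abs_sub (u t) (z t + κ * w t + κ * ((γ - 1) *
    (Real.exp (-(κ * r ^ 2) * t) * (β + a * r ^ 2 * α))))
  have habs2 := abs_add_three (z t) (κ * w t) (κ * ((γ - 1) *
    (Real.exp (-(κ * r ^ 2) * t) * (β + a * r ^ 2 * α))))
  rw [abs_mul, abs_of_pos hκ, abs_mul κ, abs_of_pos hκ] at habs2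
  have h1 := mul_le_mul_of_nonneg_left (habs.trans (add_le_add_right habs2 _)) hr.le
  refine h1.trans ?_
  have d1 : κ * (r * |w t|) ≤ 5880 * K ^ 2 * M * A := by
    calc κ * (r * |w t|) ≤ κ * (420 * K * (1 + r ^ 2) * A) := by gcongr
      _ = 420 * K * (κ * (1 + r ^ 2)) * A := by ring
      _ ≤ 420 * K * (14 * K * M) * A := by gcongr
      _ = _ := by ring
  have d2 : κ * r * |(γ - 1) * (Real.exp (-(κ * r ^ 2) * t) * (β + a * r ^ 2 * α))|
      ≤ 14 * K ^ 2 * M * A := by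
    calc _ ≤ 14 * K * M * A := by gcongr
      _ = 14 * (K * M) * A := by ring
      _ ≤ 14 * (K ^ 2 * M) * A := by gcongr
      _ = _ := by ring
  have d3 : A ≤ 196 * K ^ 2 * M * A := le_mul_of_one_le_left hA0 c1
  -- The constant 60022 is shared with the range of small κr²; here 392 + 2744 + 5880 + 14 would
  -- suffice.
  have d4 : 60022 * K ^ 2 * (κ * k) * (1 + r ^ 2) ^ 2 * A = 60022 * (K ^ 2 * M * A) := by
    rw [hM, hκk]; ring
  have d5 : 0 ≤ K ^ 2 * M * A := by positivity
  rw [d4]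
  linarith

theorem two_mul_le_one_add_sq (r : ℝ) : 2 * r ≤ 1 + r ^ 2 := by
  nlinarith [sq_nonneg (r - 1)]

set_option maxHeartbeats 800000 in
/-- The error bound for small `κ r²`. -/
theorem IsModeSystem.error_bound_low (h : IsModeSystem a γ κ r α β u u1 u2 z z1 w w1)
    (ha : 0 < a) (hK : 1 ≤ K) (haK : a ≤ K) (haK' : 1 ≤ a * K) (hκ : 0 < κ)
    (hκ1 : κ ≤ 1) (hκa : 2 * κ ≤ a) (hr : 0 < r) (hγ : 1 < γ) (hγ' : γ ≤ 2)
    (hX : 14 * K * (κ * r ^ 2) ≤ 1)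
    (hA : A = r * |α| + |β + a * r ^ 2 * α|) (t : ℝ) (ht : 0 ≤ t) :
    r * |modeError γ κ r (β + a * r ^ 2 * α) u z w t| ≤
      60022 * K ^ 2 * κ ^ 2 * (1 + r ^ 2) ^ 2 * A := by
  set J := β + a * r ^ 2 * α with hJ
  set X := κ * r ^ 2 with hXd
  have hX0 : 0 < X := by positivity
  have hX1 : X ≤ 1 :=
    (le_mul_of_one_le_left hX0.le (by linarith : 1 ≤ 14 * K)).trans hX
  have hγaX : γ * a * X ≤ 1 / 2 := by
    calc γ * a * X ≤ 2 * K * X := by gcongr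
      _ ≤ 1 / 2 := by linarith
  obtain ⟨l, hl, hlX, he, hcubic⟩ := exists_slow_root ha hγ.le hκ (by linarith) hr hγaX
  rw [← hXd] at hl hlX he
  have hl0 : 0 < l := by linarith
  have he' : X - l ≤ 2 * K * X ^ 2 := he.trans (by gcongr)
  set g := γ * X - l with hg
  have hg0 : 0 ≤ g := by
    have := le_mul_of_one_le_left hX0.le hγ.le
    rw [hg]; linarith
  have hg2 : g ≤ 2 * X := by
    have := mul_le_mul_of_nonneg_right hγ' hX0.le
    rw [hg]; linarith
  -- Vieta's relations: the cubic factors as (λ+l)(λ²+pλ+q). The pair (p, q) perturbs the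
  -- viscoelastic pair (ar², r²) through g, which is O(κr²).
  set p := (a + γ * κ) * r ^ 2 - l with hp
  have hpg : p = a * r ^ 2 + g := by rw [hp, hg, hXd]; ring
  set q := r ^ 2 + g * (a * r ^ 2 - l) with hq
  have hqB : q + l * p = r ^ 2 + γ * a * κ * r ^ 4 := by rw [hpg, hq, hg, hXd]; ring
  have hlq : l * q = κ * r ^ 4 := by
    have : q = r ^ 2 + γ * a * κ * r ^ 4 - l * p := by linarith
    rw [this, hp]; linear_combination hcubic
  have hlar : l ≤ a * r ^ 2 := hlX.trans (by rw [hXd]; gcongr; linarith)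
  have hrq : r ^ 2 ≤ q := by
    have : 0 ≤ g * (a * r ^ 2 - l) := mul_nonneg hg0 (by linarith)
    linarith
  have hqr : q ≤ 2 * r ^ 2 := by
    have h1 : g * (a * r ^ 2 - l) ≤ 2 * X * (K * r ^ 2) := by
      apply mul_le_mul hg2 _ (by linarith) (by positivity)
      have : a * r ^ 2 ≤ K * r ^ 2 := by gcongr
      linarith
    have h2 : 14 * K * X * r ^ 2 ≤ 1 * r ^ 2 := by gcongr
    linarith [sq_nonneg r]
  have hpa : a * r ^ 2 ≤ p := by linarith
  have hpa2 : p ≤ 2 * a * r ^ 2 := by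
    have : 2 * κ * r ^ 2 ≤ a * r ^ 2 := by gcongr
    linarith
  have hp0 : 0 < p := lt_of_lt_of_le (by positivity) hpa
  obtain ⟨hd0, hσ⟩ := slow_amplitude_bound (α := α) (J := J) ha hK haK hγ.le hγ' hκ hκ1 hr hXd hX
    hl hlX he'
  rw [← hp, ← hg, ← hq] at hd0 hσ
  set d := l ^ 2 - p * l + q with hd
  set σ := g * (J - l * α) / d with hσd
  set S := |J| + |α| with hS
  have hS0 : 0 ≤ S := by positivity
  -- the slow part
  set Ω : ℝ → ℝ := fun t => u2 t + p * u1 t + q * u t with hΩ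
  have hΩd : ∀ t, HasDerivAt Ω (-l * Ω t) t := fun t => by
    convert! ((h.u2_deriv t).add ((h.u1_deriv t).const_mul p)).add ((h.u_deriv t).const_mul q)
      using 1
    simp only [hΩ]
    have e1 : (a + γ * κ) * r ^ 2 = p + l := by rw [hp]; ring
    rw [e1, ← hqB, ← hlq]; ring
  have hΩ0 : Ω 0 = σ * d := by
    rw [hσd, div_mul_cancel₀ _ hd0.ne']
    simp only [hΩ, h.u_zero, h.u1_zero, h.u2_zero]
    rw [hJ, hpg, hq]; ring
  have hΩt : ∀ t, Ω t = d * (σ * Real.exp (-l * t)) := fun t => by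
    rw [eq_mul_exp_of_hasDerivAt hΩd t, hΩ0]; ring
  have hsd : ∀ t, HasDerivAt (fun t => σ * Real.exp (-l * t)) (-l * (σ * Real.exp (-l * t))) t :=
    fun t => by
      convert! (((hasDerivAt_id t).const_mul (-l)).exp).const_mul σ using 1
      simp; ring
  -- the fast part of the error
  set v : ℝ → ℝ := fun t => u t - σ * Real.exp (-l * t) - z t - κ * w t with hv
  set y : ℝ → ℝ := fun t =>
    u1 t + l * (σ * Real.exp (-l * t)) - z1 t - κ * w1 t + p * v t with hy
  -- In the oscillator with coefficients p, q, the mode z leaves g(z'+ar²z) - lgz, while the source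
  -- of κw gives -(γ-1)X(z'+ar²z). Since g - (γ-1)X = X - l is O(κ²), the O(κ) forcing disappears.
  set F : ℝ → ℝ := fun t => -((X - l) * (z1 t + a * r ^ 2 * z t)
    + κ * g * (w1 t + a * r ^ 2 * w t) - l * g * (z t + κ * w t)) with hF
  have hvd : ∀ t, HasDerivAt v (y t - p * v t) t := fun t => by
    convert! (((h.u_deriv t).sub (hsd t)).sub (h.z_deriv t)).sub ((h.w_deriv t).const_mul κ)
      using 1
    simp only [hy]; ring
  have hyd : ∀ t, HasDerivAt y (-q * v t + F t) t := fun t => by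
    convert! ((((h.u1_deriv t).add ((hsd t).const_mul l)).sub (h.z1_deriv t)).sub
      ((h.w1_deriv t).const_mul κ)).add ((hvd t).const_mul p) using 1
    have e1 : u2 t = d * (σ * Real.exp (-l * t)) - p * u1 t - q * u t := by
      rw [← hΩt]; simp only [hΩ]; ring
    simp only [hy, hF, hv]
    rw [e1, hd, hpg, hq, hg, hXd]
    ring
  have hA0 : 0 ≤ A := by rw [hA]; positivity
  have hJA : |J| ≤ A := by rw [hA]; linarith [mul_nonneg hr.le (abs_nonneg α)]
  have hαA : r * |α| ≤ A := by rw [hA]; linarith [abs_nonneg J]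
  have hr1 : r ≤ 1 + r ^ 2 := by linarith [two_mul_le_one_add_sq r]
  have hr2 : r ^ 2 ≤ 1 + r ^ 2 := by linarith
  have hFb : ∀ t, 0 ≤ t → |F t| ≤ r ^ 2 * (2000 * K * κ ^ 2 * (1 + r ^ 2) * A)
      * Real.exp (-(modeRate K r / 8) * t) := by
    intro t ht
    obtain ⟨⟨b1, b2⟩, ⟨b3, b4⟩⟩ := h.bounds ha hK haK haK' hr hγ.le hγ' hA t ht
    set ε := Real.exp (-(modeRate K r / 8) * t) with hε
    have hε0 : 0 < ε := Real.exp_pos _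
    set Q := κ ^ 2 * r ^ 2 * (1 + r ^ 2) * A * ε with hQ
    have hQ0 : 0 ≤ Q := by positivity
    have t1 : |(X - l) * (z1 t + a * r ^ 2 * z t)| ≤ 28 * K * Q := by
      rw [abs_mul, abs_of_nonneg (by linarith : 0 ≤ X - l)]
      calc (X - l) * |z1 t + a * r ^ 2 * z t| ≤ 2 * K * X ^ 2 * (14 * A * ε) := by gcongr
        _ = 28 * K * (κ ^ 2 * r ^ 2 * r ^ 2 * A * ε) := by rw [hXd]; ring
        _ ≤ 28 * K * Q := by rw [hQ]; gcongr
    have t2 : |κ * g * (w1 t + a * r ^ 2 * w t)| ≤ 840 * K * Q := by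
      rw [abs_mul, abs_of_nonneg (by positivity : 0 ≤ κ * g)]
      calc κ * g * |w1 t + a * r ^ 2 * w t|
          ≤ κ * (2 * X) * (420 * K * (1 + r ^ 2) * A * ε) := by gcongr
        _ = 840 * K * Q := by rw [hXd, hQ]; ring
    have t3 : |l * g * z t| ≤ 28 * Q := by
      rw [abs_mul, abs_of_nonneg (by positivity : 0 ≤ l * g)]
      calc l * g * |z t| ≤ X * (2 * X) * |z t| := by gcongr
        _ = 2 * (κ ^ 2 * r ^ 2 * r * (r * |z t|)) := by rw [hXd]; ring
        _ ≤ 2 * (κ ^ 2 * r ^ 2 * (1 + r ^ 2) * (14 * A * ε)) := by gcongr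
        _ = 28 * Q := by rw [hQ]; ring
    have t4 : |l * g * (κ * w t)| ≤ 840 * K * Q := by
      rw [abs_mul, abs_mul κ, abs_of_nonneg (by positivity : 0 ≤ l * g), abs_of_pos hκ]
      calc l * g * (κ * |w t|) ≤ X * (2 * X) * (κ * |w t|) := by gcongr
        _ = 2 * (κ ^ 2 * r ^ 2 * (κ * r) * (r * |w t|)) := by rw [hXd]; ring
        _ ≤ 2 * (κ ^ 2 * r ^ 2 * 1 * (420 * K * (1 + r ^ 2) * A * ε)) := by
          gcongr
          have := mul_le_mul_of_nonneg_left (two_mul_le_one_add_sq r) hκ.le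
          linarith
        _ = 840 * K * Q := by rw [hQ]; ring
    have t5 : |F t| ≤ |(X - l) * (z1 t + a * r ^ 2 * z t)| + |κ * g * (w1 t + a * r ^ 2 * w t)|
        + (|l * g * z t| + |l * g * (κ * w t)|) := by
      simp only [hF]
      rw [abs_neg, mul_add (l * g)]
      exact (abs_sub _ _).trans (add_le_add (abs_add_le _ _) (abs_add_le _ _))
    have t6 : Q ≤ K * Q := le_mul_of_one_le_left hQ0 hK
    calc |F t| ≤ 2000 * K * Q := by linarith
      _ = _ := by rw [hQ]; ring
  -- The datum w(0) = (1-γ)J offsets the heat layer at t = 0, so only the amplitude error remains.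
  have hv0 : |v 0| ≤ 18 * K * (κ * X * S) := by
    have : v 0 = -(σ - κ * (γ - 1) * J) := by
      simp only [hv, h.u_zero, h.z_zero, h.w_zero, mul_zero, Real.exp_zero]
      rw [hJ]; ring
    rw [this, abs_neg]
    exact hσ
  have hσb : |σ| ≤ 3 * (κ * S) := by
    have e1 : |κ * (γ - 1) * J| ≤ κ * S := by
      rw [abs_mul, abs_of_nonneg (mul_nonneg hκ.le (by linarith) : 0 ≤ κ * (γ - 1)), mul_assoc]
      gcongr
      have : (γ - 1) * |J| ≤ 1 * |J| := by gcongr; linarith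
      linarith [abs_nonneg α]
    have e2 : 18 * K * (κ * X * S) ≤ 2 * (κ * S) := by
      calc 18 * K * (κ * X * S) = 18 / 14 * (14 * K * X) * (κ * S) := by ring
        _ ≤ 18 / 14 * 1 * (κ * S) := by gcongr
        _ ≤ 2 * (κ * S) := by
          apply mul_le_mul_of_nonneg_right _ (by positivity); norm_num
    have e3 : |σ| ≤ |σ - κ * (γ - 1) * J| + |κ * (γ - 1) * J| := by
      simpa using abs_add_le (σ - κ * (γ - 1) * J) (κ * (γ - 1) * J)
    linarith
  -- S contains |α| where A controls only r|α|; one factor r from X makes up for this, the other is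
  -- absorbed in 1 + r².
  have hXS : X * S ≤ κ * (1 + r ^ 2) * A := by
    have e1 : r ^ 2 * |J| ≤ r ^ 2 * A := by gcongr
    have e2 : r * (r * |α|) ≤ r * A := by gcongr
    have e3 : r * |J| + r * (r * |α|) = r * A := by rw [hA]; ring
    have e4 : r ^ 2 * S ≤ (1 + r ^ 2) * A := by
      have : r ^ 2 * S = r ^ 2 * |J| + r * (r * |α|) := by rw [hS]; ring
      rw [this]
      by_cases hr' : r ≤ 1
      · have : r * (r * |α|) ≤ 1 * A := by gcongr
        linarith
      · push Not at hr'
        have e5 : r * |J| ≤ r ^ 2 * |J| := by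
            gcongr; exact le_self_pow₀ hr'.le two_ne_zero
        have e6 : r ^ 2 * |J| + r * (r * |α|) ≤ r ^ 2 * |J| + r ^ 2 * (r * |α|) := by
          gcongr; exact le_self_pow₀ hr'.le two_ne_zero
        have e7 : r ^ 2 * |J| + r ^ 2 * (r * |α|) = r ^ 2 * A := by rw [hA]; ring
        linarith
    calc X * S = κ * (r ^ 2 * S) := by rw [hXd]; ring
      _ ≤ κ * ((1 + r ^ 2) * A) := by gcongr
      _ = _ := by ring
  have hy0 : |y 0| ≤ 3 * (κ * X * S) + 2 * K * r ^ 2 * (18 * K * (κ * X * S)) := by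
    have : y 0 = l * σ + p * v 0 := by
      simp only [hy, h.u1_zero, h.z1_zero, h.w1_zero, mul_zero, Real.exp_zero]; ring
    rw [this]
    refine (abs_add_le _ _).trans ?_
    rw [abs_mul, abs_mul, abs_of_pos hl0, abs_of_pos hp0]
    have e1 : l * |σ| ≤ X * (3 * (κ * S)) := by gcongr
    have e2 : p * |v 0| ≤ 2 * K * r ^ 2 * (18 * K * (κ * X * S)) := by
      gcongr
      exact hpa2.trans (by gcongr)
    linarith
  have hfast := (damped_oscillator_bound (p := p) (q := q) (η := modeRate K r)
    (μ := modeRate K r / 8) (r := r) (Φ := r ^ 2 * (2000 * K * κ ^ 2 * (1 + r ^ 2) * A))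
    hp0 (modeRate_pos hK hr) hr (by positivity) hrq hqr
    ((four_mul_modeRate_le hK haK').trans hpa) ((two_mul_mul_modeRate_le hK haK hpa2).trans hrq)
    (by linarith) (fun t _ => hvd t) (fun t _ => hyd t) hFb t ht).1
  rw [div_modeRate hK hr] at hfast
  have hexp : Real.exp (-(modeRate K r / 8) * t) ≤ 1 := Real.exp_le_one_iff.2 (by
    have := mul_nonneg (modeRate_pos hK hr).le ht
    linarith)
  set R := κ ^ 2 * (1 + r ^ 2) ^ 2 * A with hR
  have hR0 : 0 ≤ R := by positivity
  have hκXS : κ * X * S ≤ κ ^ 2 * (1 + r ^ 2) * A := by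
    calc κ * X * S = κ * (X * S) := by ring
      _ ≤ κ * (κ * (1 + r ^ 2) * A) := by gcongr
      _ = _ := by ring
  have hκXS0 : 0 ≤ κ * X * S := by positivity
  have hrR : (1 + r ^ 2) * (κ * X * S) ≤ R := by
    calc (1 + r ^ 2) * (κ * X * S) ≤ (1 + r ^ 2) * (κ ^ 2 * (1 + r ^ 2) * A) := by gcongr
      _ = R := by rw [hR]; ring
  have hrR1 : r * (κ * X * S) ≤ R := le_trans (by gcongr) hrR
  have hrR2 : r ^ 2 * (κ * X * S) ≤ R := le_trans (by gcongr) hrR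
  have hrR3 : κ * X * S ≤ R := le_trans (le_mul_of_one_le_left hκXS0
    (le_add_of_nonneg_right (sq_nonneg r))) hrR
  have hK2 : K ≤ K ^ 2 := le_self_pow₀ hK two_ne_zero
  have hKR : K * R ≤ K ^ 2 * R := by gcongr
  have hRK : R ≤ K * R := le_mul_of_one_le_left hR0 hK
  -- The constants add up to 7·(36 + 39 + 8000) = 56525.
  have hfast' : r * |v t| ≤ 60000 * K ^ 2 * R := by
    refine hfast.trans ((mul_le_of_le_one_right (by positivity) hexp).trans ?_)
    have f1 : 2 * r * |v 0| ≤ 36 * K ^ 2 * R := by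
      calc 2 * r * |v 0| ≤ 2 * r * (18 * K * (κ * X * S)) := by gcongr
        _ = 36 * K * (r * (κ * X * S)) := by ring
        _ ≤ 36 * K ^ 2 * R := by gcongr
    have f2 : |y 0| ≤ 39 * K ^ 2 * R := by
      have g1 : K ^ 2 * (r ^ 2 * (κ * X * S)) ≤ K ^ 2 * R := by gcongr
      have g2 : |y 0| ≤ 3 * (κ * X * S) + 36 * (K ^ 2 * (r ^ 2 * (κ * X * S))) := by
        refine hy0.trans (le_of_eq (by ring))
      linarith
    have f3 : 4 * K * (1 + r ^ 2) * (2000 * K * κ ^ 2 * (1 + r ^ 2) * A)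
        = 8000 * (K ^ 2 * R) := by rw [hR]; ring
    rw [f3]
    have : 0 ≤ K ^ 2 * R := by positivity
    linarith
  have hslow : |σ * Real.exp (-l * t) - κ * ((γ - 1) * (Real.exp (-X * t) * J))|
      ≤ 22 * K * (κ * X * S) := by
    have e1 : σ * Real.exp (-l * t) - κ * ((γ - 1) * (Real.exp (-X * t) * J))
        = (σ - κ * (γ - 1) * J) * Real.exp (-l * t)
          + κ * (γ - 1) * J * (Real.exp (-l * t) - Real.exp (-X * t)) := by ring
    rw [e1]
    refine (abs_add_le _ _).trans ?_
    rw [abs_mul, abs_mul (κ * (γ - 1) * J), abs_of_pos (Real.exp_pos _)]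
    have e2 : Real.exp (-l * t) ≤ 1 := Real.exp_le_one_iff.2 (by
      have := mul_nonneg hl0.le ht
      linarith)
    have e3 : (X - l) / l ≤ 4 * K * X := by
      rw [div_le_iff₀ hl0]
      calc X - l ≤ 2 * K * X ^ 2 := he'
        _ = 4 * K * X * (X / 2) := by ring
        _ ≤ 4 * K * X * l := by gcongr
    have e4 := (abs_exp_sub_exp_le hl0 hlX ht).trans e3
    have e5 : |κ * (γ - 1) * J| ≤ κ * S := by
      rw [abs_mul, abs_of_nonneg (mul_nonneg hκ.le (by linarith) : 0 ≤ κ * (γ - 1)), mul_assoc]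
      gcongr
      have : (γ - 1) * |J| ≤ 1 * |J| := by gcongr; linarith
      linarith [abs_nonneg α]
    calc |σ - κ * (γ - 1) * J| * Real.exp (-l * t)
          + |κ * (γ - 1) * J| * |Real.exp (-l * t) - Real.exp (-X * t)|
        ≤ 18 * K * (κ * X * S) * 1 + κ * S * (4 * K * X) := by gcongr
      _ = _ := by ring
  have hsplit : modeError γ κ r J u z w t = v t
      + (σ * Real.exp (-l * t) - κ * ((γ - 1) * (Real.exp (-X * t) * J))) := by
    simp only [modeError, hv]; rw [hXd]; ring
  rw [hsplit]
  calc r * |v t + (σ * Real.exp (-l * t) - κ * ((γ - 1) * (Real.exp (-X * t) * J)))|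
      ≤ r * (|v t| + |σ * Real.exp (-l * t) - κ * ((γ - 1) * (Real.exp (-X * t) * J))|) := by
        gcongr; exact abs_add_le _ _
    _ ≤ r * |v t| + r * (22 * K * (κ * X * S)) := by
        rw [mul_add]; gcongr
    _ = r * |v t| + 22 * K * (r * (κ * X * S)) := by ring
    _ ≤ 60000 * K ^ 2 * R + 22 * K ^ 2 * R := by gcongr
    _ = _ := by rw [hR]; ring

/-- The error bound for a single mode, uniformly in time and frequency. -/
theorem exists_mode_error_bound {a γ : ℝ} (ha : 0 < a) (hγ : 1 < γ) (hγ' : γ ≤ 2) :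
    ∃ κ₀ : ℝ, 0 < κ₀ ∧ ∃ C : ℝ, 0 < C ∧ ∀ κ r α β : ℝ, 0 < κ → κ ≤ κ₀ → 0 < r →
      ∀ u u1 u2 z z1 w w1 : ℝ → ℝ, IsModeSystem a γ κ r α β u u1 u2 z z1 w w1 →
      ∀ t, 0 ≤ t → r * |modeError γ κ r (β + a * r ^ 2 * α) u z w t| ≤
        C * (κ * √κ) * (1 + r ^ 2) ^ 2 * (r * |α| + |β + a * r ^ 2 * α|) := by
  -- One constant that dominates 1, a and 1/a at once.
  set K := 1 + a + 1 / a with hKd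
  have ha' : 0 < 1 / a := by positivity
  have hK : 1 ≤ K := by linarith
  have haK : a ≤ K := by linarith
  have haK' : 1 ≤ a * K := by
    have : a * (1 / a) = 1 := by field_simp
    rw [hKd]; nlinarith
  -- The first bound also gives κ ≤ 1, hence κ² ≤ κ√κ. The second keeps the damping p at most 2ar².
  refine ⟨1 / (14 * K) ⊓ a / 2, by positivity, 60022 * K ^ 2, by positivity, ?_⟩
  intro κ r α β hκ hκ0 hr u u1 u2 z z1 w w1 h t ht
  have hκ1 : 14 * K * κ ≤ 1 := by
    have := (le_inf_iff.1 hκ0).1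
    rw [le_div_iff₀ (by positivity)] at this
    linarith
  have hκ2 := (le_inf_iff.1 hκ0).2
  by_cases hX : 1 ≤ 14 * K * (κ * r ^ 2)
  · exact h.error_bound_high ha hK haK haK' hκ hκ1 hr hγ hγ' hX rfl t ht
  · push Not at hX
    have hκ3 : κ ≤ 1 := by nlinarith
    refine (h.error_bound_low ha hK haK haK' hκ hκ3 (by linarith) hr hγ hγ' hX.le rfl t ht).trans ?_
    have : κ ≤ √κ := Real.le_sqrt_of_sq_le (by nlinarith)
    rw [sq κ]
    gcongr

end

/-! ### Existence of modes depending continuously on frequency -/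

/-- Solution of a linear system of ordinary differential equations depending continuously on a
parameter. -/
theorem exists_linear_flow {m : ℕ} (M : ℝ → Matrix (Fin m) (Fin m) ℝ) (hM : Continuous M)
    (x : ℝ → Fin m → ℝ) (hx : Continuous x) :
    ∃ v : ℝ → ℝ → Fin m → ℝ, (∀ t r, HasDerivAt (fun τ => v τ r) ((M r).mulVec (v t r)) t) ∧
      (∀ r, v 0 r = x r) ∧ Continuous (Function.uncurry v) := by
  set L : (Matrix (Fin m) (Fin m) ℝ) →ₗ[ℝ] ((Fin m → ℝ) →L[ℝ] (Fin m → ℝ)) :=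
    (LinearMap.toContinuousLinearMap : ((Fin m → ℝ) →ₗ[ℝ] (Fin m → ℝ)) ≃ₗ[ℝ] _).toLinearMap ∘ₗ
      (Matrix.toLin' : Matrix (Fin m) (Fin m) ℝ ≃ₗ[ℝ] _).toLinearMap with hL
  have hLa : ∀ A w, L A w = A.mulVec w := fun A w => by simp [hL]
  have hLc : Continuous fun r => L (M r) :=
    (LinearMap.continuous_of_finiteDimensional L).comp hM
  refine ⟨fun t r => NormedSpace.exp (t • L (M r)) (x r), ?_, ?_, ?_⟩
  · intro t r
    have h := (hasDerivAt_exp_smul_const' (𝕂 := ℝ) (L (M r)) t).clm_apply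
      (hasDerivAt_const t (x r))
    simpa [hLa] using h
  · intro r; simp
  · let _ : NormedAlgebra ℚ ((Fin m → ℝ) →L[ℝ] (Fin m → ℝ)) :=
      NormedAlgebra.restrictScalars ℚ ℝ _
    have h1 : Continuous fun p : ℝ × ℝ => NormedSpace.exp (p.1 • L (M p.2)) :=
      NormedSpace.exp_continuous.comp (continuous_fst.smul (hLc.comp continuous_snd))
    exact h1.clm_apply (hx.comp continuous_snd)

/-- Modes with prescribed data `α r`, `β r`, depending continuously on time and frequency. -/
theorem exists_modeSystem (a γ κ : ℝ) (α β : ℝ → ℝ) (hα : Continuous α) (hβ : Continuous β) :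
    ∃ u u1 u2 z z1 w w1 : ℝ → ℝ → ℝ,
      (∀ r, IsModeSystem a γ κ r (α r) (β r) (fun t => u t r) (fun t => u1 t r) (fun t => u2 t r)
        (fun t => z t r) (fun t => z1 t r) (fun t => w t r) (fun t => w1 t r)) ∧
      Continuous (Function.uncurry u) ∧ Continuous (Function.uncurry u1) ∧
      Continuous (Function.uncurry u2) ∧ Continuous (Function.uncurry z) ∧
      Continuous (Function.uncurry z1) ∧ Continuous (Function.uncurry w) ∧
      Continuous (Function.uncurry w1) := by
  obtain ⟨v, hv, hv0, hvc⟩ := exists_linear_flow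
    (fun r => !![0, 1, 0; 0, 0, 1;
      -(κ * r ^ 4), -(r ^ 2 + γ * a * κ * r ^ 4), -((a + γ * κ) * r ^ 2)])
    (by
      refine continuous_matrix fun i j => ?_
      fin_cases i <;> fin_cases j <;> simp <;> fun_prop)
    (fun r => ![α r, β r, -(a * r ^ 2) * β r - r ^ 2 * α r])
    (continuous_pi fun i => by fin_cases i <;> simp <;> fun_prop)
  -- z and w form one block-triangular system, since z drives w.
  obtain ⟨y, hy, hy0, hyc⟩ := exists_linear_flow
    (fun r => !![0, 1, 0, 0; -r ^ 2, -(a * r ^ 2), 0, 0; 0, 0, 0, 1;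
      -((γ - 1) * r ^ 2 * (a * r ^ 2)), -((γ - 1) * r ^ 2), -r ^ 2, -(a * r ^ 2)])
    (by
      refine continuous_matrix fun i j => ?_
      fin_cases i <;> fin_cases j <;> simp <;> fun_prop)
    (fun r => ![α r, β r, (1 - γ) * (β r + a * r ^ 2 * α r), 0])
    (continuous_pi fun i => by fin_cases i <;> simp <;> fun_prop)
  have hvi := fun t r i => (hasDerivAt_pi.1 (hv t r)) i
  have hyi := fun t r i => (hasDerivAt_pi.1 (hy t r)) i
  have hvci := fun i => (continuous_apply i).comp hvc
  have hyci := fun i => (continuous_apply i).comp hyc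
  refine ⟨fun t r => v t r 0, fun t r => v t r 1, fun t r => v t r 2, fun t r => y t r 0,
    fun t r => y t r 1, fun t r => y t r 2, fun t r => y t r 3, fun r => ⟨fun t => ?_, fun t => ?_,
    fun t => ?_, fun t => ?_, fun t => ?_, fun t => ?_, fun t => ?_, ?_, ?_, ?_, ?_, ?_, ?_, ?_⟩,
    hvci 0, hvci 1, hvci 2, hyci 0, hyci 1, hyci 2, hyci 3⟩
  · convert! hvi t r 0 using 1; simp [Matrix.mulVec, dotProduct, Fin.sum_univ_succ]
  · convert! hvi t r 1 using 1; simp [Matrix.mulVec, dotProduct, Fin.sum_univ_succ]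
  · convert! hvi t r 2 using 1; simp [Matrix.mulVec, dotProduct, Fin.sum_univ_succ]; ring
  · convert! hyi t r 0 using 1; simp [Matrix.mulVec, dotProduct, Fin.sum_univ_succ]
  · convert! hyi t r 1 using 1; simp [Matrix.mulVec, dotProduct, Fin.sum_univ_succ]; ring
  · convert! hyi t r 2 using 1; simp [Matrix.mulVec, dotProduct, Fin.sum_univ_succ]
  · convert! hyi t r 3 using 1; simp [Matrix.mulVec, dotProduct, Fin.sum_univ_succ]; ring
  all_goals simp [hv0, hy0]

/-! ### Uniqueness for an infinite hierarchy of scalar equations -/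

/-- One step of Picard iteration: each integration from 0 raises the power of t and the factorial
together. -/
theorem norm_le_pow_div_factorial {f f' : ℝ → ℂ} {B T : ℝ} {n : ℕ}
    (hf : ∀ t, 0 ≤ t → HasDerivWithinAt f (f' t) (Ici 0) t) (h0 : f 0 = 0)
    (hb : ∀ t, 0 ≤ t → t ≤ T → ‖f' t‖ ≤ B * (t ^ n / n.factorial)) (t : ℝ) (ht : 0 ≤ t)
    (htT : t ≤ T) : ‖f t‖ ≤ B * (t ^ (n + 1) / (n + 1).factorial) := by
  have hB : ∀ x : ℝ, HasDerivAt (fun t : ℝ => B * (t ^ (n + 1) / (n + 1).factorial))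
      (B * (x ^ n / n.factorial)) x := fun x => by
    convert! ((hasDerivAt_pow (n + 1) x).div_const ((n + 1).factorial : ℝ)).const_mul B using 2
    rw [Nat.factorial_succ]
    push_cast
    field_simp
  refine image_norm_le_of_norm_deriv_right_le_deriv_boundary (a := 0) (b := T) (f := f) (f' := f')
    (fun x hx => ((hf x hx.1).continuousWithinAt).mono (fun y hy => hy.1))
    (fun x hx => (hf x hx.1).mono (Ici_subset_Ici.2 hx.1)) (by simp [h0]) hB
    (fun x hx => hb x hx.1 hx.2.le) ⟨ht, htT⟩

/-- Uniqueness for a hierarchy of scalar third-order equations, where the `k`-th equation is driven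
by the next two and only the undifferentiated functions are bounded geometrically in `k`. -/
theorem hierarchy_eq_zero {D0 D1 D2 : ℕ → ℝ → ℂ} {c1 c2 c3 c4 : ℂ}
    (h0 : ∀ k t, 0 ≤ t → HasDerivWithinAt (D0 k) (D1 k t) (Ici 0) t)
    (h1 : ∀ k t, 0 ≤ t → HasDerivWithinAt (D1 k) (D2 k t) (Ici 0) t)
    (h2 : ∀ k t, 0 ≤ t → HasDerivWithinAt (D2 k) (-(c1 * D2 (k + 1) t + c2 * D1 (k + 1) t
      + c3 * D1 (k + 2) t + c4 * D0 (k + 2) t)) (Ici 0) t)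
    (z0 : ∀ k, D0 k 0 = 0) (z1 : ∀ k, D1 k 0 = 0) (z2 : ∀ k, D2 k 0 = 0)
    (hb : ∀ T : ℝ, ∃ M R : ℝ, ∀ k t, 0 ≤ t → t ≤ T → ‖D0 k t‖ ≤ M * R ^ k)
    (k : ℕ) (T : ℝ) (hT : 0 ≤ T) : D0 k T = 0 := by
  obtain ⟨M, R, hMR⟩ : ∃ M R : ℝ, 0 ≤ M ∧ 1 ≤ R ∧
      ∀ k t, 0 ≤ t → t ≤ T → ‖D0 k t‖ ≤ M * R ^ k := by
    obtain ⟨M, R, h⟩ := hb T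
    refine ⟨|M|, 1 + |R|, abs_nonneg _, by linarith [abs_nonneg R], fun k t ht htT =>
      (h k t ht htT).trans ?_⟩
    calc M * R ^ k ≤ |M * R ^ k| := le_abs_self _
      _ = |M| * |R| ^ k := by rw [abs_mul, abs_pow]
      _ ≤ |M| * (1 + |R|) ^ k := by
        gcongr
        linarith
  obtain ⟨hM, hR, hMR⟩ := hMR
  have hR0 : 0 < R := by linarith
  set L : ℝ := (‖c1‖ + ‖c2‖ + ‖c3‖ + ‖c4‖) * R ^ 2 with hL
  have hL0 : 0 ≤ L := by positivity
  set Q : ℝ := L * ((T + 1) * T + 1) with hQ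
  have hQ0 : 0 ≤ Q := by positivity
  have hL1 : ‖c1‖ * R ^ 2 ≤ L := by
    rw [hL]
    exact mul_le_mul_of_nonneg_right (by linarith [norm_nonneg c2, norm_nonneg c3, norm_nonneg c4])
      (sq_nonneg R)
  have hL23 : (‖c2‖ + ‖c3‖) * R ^ 2 ≤ L := by
    rw [hL]
    exact mul_le_mul_of_nonneg_right (by linarith [norm_nonneg c1, norm_nonneg c4]) (sq_nonneg R)
  have hL4 : ‖c4‖ * R ^ 2 ≤ L := by
    rw [hL]
    exact mul_le_mul_of_nonneg_right (by linarith [norm_nonneg c1, norm_nonneg c2, norm_nonneg c3])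
      (sq_nonneg R)
  have hR1 : R ≤ R ^ 2 := le_self_pow₀ hR two_ne_zero
  -- The factor tⁿ/n! beats the geometric growth in k. D1 and D2 have no a priori bound, so each
  -- round integrates combinations whose derivatives involve only terms already estimated: the top
  -- one has derivative -c4·D0 (k+2), and D1, then D0, are recovered from it. The surplus powers of
  -- t are replaced by powers of T, which gives Q.
  have claim : ∀ n k t, 0 ≤ t → t ≤ T →
      ‖D0 k t‖ ≤ (M * R ^ k * Q ^ n) * (t ^ n / n.factorial) := by
    intro n
    induction n with
    | zero =>
      intro k t ht htT
      simpa using hMR k t ht htT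
    | succ n ih =>
      intro k
      set P := M * R ^ k * Q ^ n with hP
      have hP0 : 0 ≤ P := by positivity
      have s1 : ∀ t, 0 ≤ t → t ≤ T → ‖D0 (k + 1) t‖ ≤ P * R ^ 2 * (t ^ n / n.factorial) :=
        fun t ht htT => (ih (k + 1) t ht htT).trans (by
          apply mul_le_mul_of_nonneg_right _ (by positivity)
          calc M * R ^ (k + 1) * Q ^ n = P * R := by rw [hP]; ring
            _ ≤ P * R ^ 2 := by gcongr)
      have s2 : ∀ t, 0 ≤ t → t ≤ T → ‖D0 (k + 2) t‖ ≤ P * R ^ 2 * (t ^ n / n.factorial) :=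
        fun t ht htT => (ih (k + 2) t ht htT).trans (le_of_eq (by rw [hP]; ring))
      have hpow : ∀ t, 0 ≤ t → t ≤ T →
          t ^ (n + 1) / ((n + 1).factorial : ℝ) ≤ T * (t ^ n / n.factorial) := by
        intro t ht htT
        have hn : (n.factorial : ℝ) ≤ (n + 1).factorial := by
          exact_mod_cast Nat.factorial_le (Nat.le_succ n)
        calc t ^ (n + 1) / ((n + 1).factorial : ℝ) ≤ t ^ (n + 1) / (n.factorial : ℝ) := by gcongr
          _ = t * (t ^ n / n.factorial) := by ring
          _ ≤ T * (t ^ n / n.factorial) := by gcongr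
      -- second-order part
      have g1 := norm_le_pow_div_factorial (B := P * L) (T := T) (n := n)
        (f := fun t => D2 k t + c1 * D1 (k + 1) t + c2 * D0 (k + 1) t + c3 * D0 (k + 2) t)
        (f' := fun t => -(c4 * D0 (k + 2) t))
        (fun t ht => by
          convert! ((((h2 k t ht).add ((h1 (k + 1) t ht).const_mul c1)).add
            ((h0 (k + 1) t ht).const_mul c2)).add ((h0 (k + 2) t ht).const_mul c3)) using 1
          ring) (by simp [z0, z1, z2])
        (fun t ht htT => by
          rw [norm_neg, norm_mul]
          calc ‖c4‖ * ‖D0 (k + 2) t‖ ≤ ‖c4‖ * (P * R ^ 2 * (t ^ n / n.factorial)) := by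
                gcongr; exact s2 t ht htT
            _ = P * (‖c4‖ * R ^ 2) * (t ^ n / n.factorial) := by ring
            _ ≤ P * L * (t ^ n / n.factorial) := by
                gcongr)
      -- first-order part
      have g2 := norm_le_pow_div_factorial (B := P * L * (T + 1)) (T := T) (n := n)
        (f := fun t => D1 k t + c1 * D0 (k + 1) t)
        (f' := fun t => D2 k t + c1 * D1 (k + 1) t)
        (fun t ht => (h1 k t ht).add ((h0 (k + 1) t ht).const_mul c1)) (by simp [z0, z1])
        (fun t ht htT => by
          have e : D2 k t + c1 * D1 (k + 1) t = (D2 k t + c1 * D1 (k + 1) t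
              + c2 * D0 (k + 1) t + c3 * D0 (k + 2) t) - (c2 * D0 (k + 1) t
              + c3 * D0 (k + 2) t) := by ring
          rw [e]
          refine (norm_sub_le _ _).trans ((add_le_add (g1 t ht htT) (norm_add_le _ _)).trans ?_)
          rw [norm_mul, norm_mul]
          calc P * L * (t ^ (n + 1) / (n + 1).factorial)
                + (‖c2‖ * ‖D0 (k + 1) t‖ + ‖c3‖ * ‖D0 (k + 2) t‖)
              ≤ P * L * (T * (t ^ n / n.factorial))
                + (‖c2‖ * (P * R ^ 2 * (t ^ n / n.factorial))
                + ‖c3‖ * (P * R ^ 2 * (t ^ n / n.factorial))) := by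
                gcongr
                · exact hpow t ht htT
                · exact s1 t ht htT
                · exact s2 t ht htT
            _ = P * L * (T * (t ^ n / n.factorial))
                + P * ((‖c2‖ + ‖c3‖) * R ^ 2) * (t ^ n / n.factorial) := by ring
            _ ≤ P * L * (T * (t ^ n / n.factorial)) + P * L * (t ^ n / n.factorial) := by
                gcongr
            _ = _ := by ring)
      have g3 := norm_le_pow_div_factorial (B := P * Q) (T := T) (n := n)
        (f := D0 k) (f' := D1 k) (h0 k) (z0 k)
        (fun t ht htT => by
          have e : D1 k t = (D1 k t + c1 * D0 (k + 1) t) - c1 * D0 (k + 1) t := by ring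
          rw [e]
          refine (norm_sub_le _ _).trans ((add_le_add_left (g2 t ht htT) _).trans ?_)
          rw [norm_mul]
          calc P * L * (T + 1) * (t ^ (n + 1) / (n + 1).factorial) + ‖c1‖ * ‖D0 (k + 1) t‖
              ≤ P * L * (T + 1) * (T * (t ^ n / n.factorial))
                + ‖c1‖ * (P * R ^ 2 * (t ^ n / n.factorial)) := by
                gcongr
                · exact hpow t ht htT
                · exact s1 t ht htT
            _ = P * L * (T + 1) * (T * (t ^ n / n.factorial))
                + P * (‖c1‖ * R ^ 2) * (t ^ n / n.factorial) := by ring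
            _ ≤ P * L * (T + 1) * (T * (t ^ n / n.factorial))
                + P * L * (t ^ n / n.factorial) := by
                gcongr
            _ = _ := by rw [hQ]; ring)
      intro t ht htT
      refine (g3 t ht htT).trans (le_of_eq ?_)
      rw [hP, pow_succ Q n]; ring
  have hlim := (FloorSemiring.tendsto_pow_div_factorial_atTop (Q * T)).const_mul (M * R ^ k)
  rw [mul_zero] at hlim
  have hle : ‖D0 k T‖ ≤ 0 := ge_of_tendsto hlim (Filter.Eventually.of_forall fun n => by
    refine (claim n k T hT le_rfl).trans (le_of_eq ?_)
    rw [mul_pow Q T]; ring)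
  exact norm_le_zero_iff.1 hle

/-! ### Distributions and multipliers tested on the frequency side -/

variable {n : ℕ}

/-- The angular frequency `2 π |ξ|`. -/
def freq (ξ : EuclideanSpace ℝ (Fin n)) : ℝ := 2 * Real.pi * ‖ξ‖

theorem continuous_freq : Continuous (freq (n := n)) := by
  unfold freq; fun_prop

theorem freq_nonneg (ξ : EuclideanSpace ℝ (Fin n)) : 0 ≤ freq ξ := by
  unfold freq; positivity

theorem hasTemperateGrowth_freq_sq :
    (fun ξ : EuclideanSpace ℝ (Fin n) => ((freq ξ ^ 2 : ℝ) : ℂ)).HasTemperateGrowth := by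
  have : (fun ξ : EuclideanSpace ℝ (Fin n) => ((freq ξ ^ 2 : ℝ) : ℂ))
      = fun ξ => (((2 * Real.pi) ^ 2 * ‖ξ‖ ^ 2 : ℝ) : ℂ) := by
    ext ξ; simp [freq, mul_pow]
  rw [this]
  fun_prop

/-- Multiplication of test functions by the symbol of `-Δ`. -/
def freqSqMul : 𝓢(EuclideanSpace ℝ (Fin n), ℂ) →L[ℂ] 𝓢(EuclideanSpace ℝ (Fin n), ℂ) :=
  SchwartzMap.smulLeftCLM ℂ (fun ξ => ((freq ξ ^ 2 : ℝ) : ℂ))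

theorem freqSqMul_apply (φ : 𝓢(EuclideanSpace ℝ (Fin n), ℂ)) (ξ : EuclideanSpace ℝ (Fin n)) :
    freqSqMul φ ξ = ((freq ξ ^ 2 : ℝ) : ℂ) * φ ξ := by
  rw [freqSqMul, SchwartzMap.smulLeftCLM_apply_apply hasTemperateGrowth_freq_sq, smul_eq_mul]

theorem freqSqMul_iterate_apply (φ : 𝓢(EuclideanSpace ℝ (Fin n), ℂ)) (k : ℕ)
    (ξ : EuclideanSpace ℝ (Fin n)) :
    (freqSqMul^[k] φ) ξ = (((freq ξ ^ 2) ^ k : ℝ) : ℂ) * φ ξ := by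
  induction k with
  | zero => simp
  | succ k ih =>
    rw [Function.iterate_succ_apply', freqSqMul_apply, ih]
    push_cast; ring

theorem hasCompactSupport_freqSqMul {φ : 𝓢(EuclideanSpace ℝ (Fin n), ℂ)}
    (hφ : HasCompactSupport φ) : HasCompactSupport (freqSqMul φ) := by
  have : (freqSqMul φ : EuclideanSpace ℝ (Fin n) → ℂ)
      = fun ξ => ((freq ξ ^ 2 : ℝ) : ℂ) * φ ξ := funext (freqSqMul_apply φ)
  rw [this]
  exact hφ.mul_left

theorem hasCompactSupport_freqSqMul_iterate {φ : 𝓢(EuclideanSpace ℝ (Fin n), ℂ)}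
    (hφ : HasCompactSupport φ) (k : ℕ) : HasCompactSupport (freqSqMul^[k] φ) := by
  induction k with
  | zero => simpa using hφ
  | succ k ih =>
    rw [Function.iterate_succ_apply']
    exact hasCompactSupport_freqSqMul ih

/-- Moving the symbol onto the test function keeps the distribution itself untouched; iterating this
is what indexes the hierarchy. -/
theorem fourier_laplacian_apply (u : TDist n) (φ : 𝓢(EuclideanSpace ℝ (Fin n), ℂ)) :
    𝓕 (Δ u) φ = -(𝓕 u (freqSqMul φ)) := by
  rw [TemperedDistribution.laplacian_eq_fourierMultiplierCLM,
    TemperedDistribution.fourierMultiplierCLM_apply]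
  have h2 : ∀ v : TDist n, 𝓕 ((-(2 * Real.pi) ^ 2 : ℝ) • v) φ = (-(2 * Real.pi) ^ 2 : ℝ) • 𝓕 v φ :=
    fun v => rfl
  rw [h2, FourierTransform.fourier_fourierInv_eq,
    TemperedDistribution.smulLeftCLM_apply_apply]
  have h1 : freqSqMul φ = ((2 * Real.pi) ^ 2 : ℝ) • SchwartzMap.smulLeftCLM ℂ
      (fun ξ : EuclideanSpace ℝ (Fin n) => ((‖ξ‖ ^ 2 : ℝ) : ℂ)) φ := by
    ext ξ
    rw [freqSqMul_apply, smul_apply, SchwartzMap.smulLeftCLM_apply_apply (by fun_prop)]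
    simp [freq]; ring
  rw [h1]
  have h3 : ∀ (c : ℝ) ψ, (𝓕 u) (c • ψ) = c • (𝓕 u ψ) := fun c ψ =>
    ((𝓕 u : TDist n).toLinearMap.map_smul_of_tower c ψ)
  rw [h3]
  simp

theorem fourier_L2_apply (f : L2Space n) (φ : 𝓢(EuclideanSpace ℝ (Fin n), ℂ)) :
    𝓕 (f : TDist n) φ = ∫ ξ, φ ξ * (𝓕 f : L2Space n) ξ := by
  rw [Lp.fourier_toTemperedDistribution_eq, Lp.toTemperedDistribution_apply]
  rfl

theorem locallyIntegrable_L2 (f : L2Space n) : LocallyIntegrable f volume :=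
  (Lp.memLp f).locallyIntegrable (by norm_num)

theorem exists_freq_le {φ : EuclideanSpace ℝ (Fin n) → ℂ} (hφ : HasCompactSupport φ) :
    ∃ R : ℝ, 0 ≤ R ∧ ∀ ξ, φ ξ ≠ 0 → freq ξ ≤ R := by
  obtain ⟨R, hR⟩ := hφ.isCompact.isBounded.exists_norm_le
  refine ⟨2 * Real.pi * |R|, by positivity, fun ξ hξ => ?_⟩
  unfold freq
  have := hR ξ (subset_tsupport _ hξ)
  gcongr
  exact this.trans (le_abs_self R)

/-- The pairing of the multiplier `m(2π|ξ|)` applied to `f` with a test function. -/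
def multPair (m : ℝ → ℝ) (f : L2Space n) (φ : 𝓢(EuclideanSpace ℝ (Fin n), ℂ)) : ℂ :=
  ∫ ξ, ((m (freq ξ) : ℝ) : ℂ) * f ξ * φ ξ

/-- Compact support of φ makes continuity of m sufficient; no growth condition on the multiplier is
needed. -/
theorem integrable_multPair {m : ℝ → ℝ} (hm : Continuous m) (f : L2Space n)
    {φ : 𝓢(EuclideanSpace ℝ (Fin n), ℂ)} (hφ : HasCompactSupport φ) :
    Integrable (fun ξ => ((m (freq ξ) : ℝ) : ℂ) * f ξ * φ ξ) := by
  have hc : Continuous fun ξ : EuclideanSpace ℝ (Fin n) => ((m (freq ξ) : ℝ) : ℂ) * φ ξ :=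
    (Complex.continuous_ofReal.comp (hm.comp continuous_freq)).mul φ.continuous
  have := (locallyIntegrable_L2 f).integrable_smul_left_of_hasCompactSupport hc
    (hφ.mul_left)
  refine this.congr (Filter.Eventually.of_forall fun ξ => ?_)
  simp only [smul_eq_mul]; ring

theorem multPair_add {m k : ℝ → ℝ} (hm : Continuous m) (hk : Continuous k) (f : L2Space n)
    {φ : 𝓢(EuclideanSpace ℝ (Fin n), ℂ)} (hφ : HasCompactSupport φ) :
    multPair (fun r => m r + k r) f φ = multPair m f φ + multPair k f φ := by
  unfold multPair
  rw [← integral_add (integrable_multPair hm f hφ) (integrable_multPair hk f hφ)]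
  congr 1; ext ξ; push_cast; ring

theorem multPair_const_mul (c : ℝ) (m : ℝ → ℝ) (f : L2Space n)
    (φ : 𝓢(EuclideanSpace ℝ (Fin n), ℂ)) :
    multPair (fun r => c * m r) f φ = c * multPair m f φ := by
  unfold multPair
  rw [← integral_const_mul]
  congr 1; ext ξ; push_cast; ring

theorem multPair_sq_mul (m : ℝ → ℝ) (f : L2Space n) (φ : 𝓢(EuclideanSpace ℝ (Fin n), ℂ)) :
    multPair (fun r => r ^ 2 * m r) f φ = multPair m f (freqSqMul φ) := by
  unfold multPair
  congr 1; ext ξ; rw [freqSqMul_apply]; push_cast; ring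

theorem exists_bound_multiplier {m : ℝ → ℝ → ℝ} (hm : Continuous fun p : ℝ × ℝ => m p.1 p.2)
    (a b R : ℝ) : ∃ C : ℝ, 0 ≤ C ∧ ∀ t r, a ≤ t → t ≤ b → 0 ≤ r → r ≤ R → |m t r| ≤ C := by
  obtain ⟨C, hC⟩ := (isCompact_Icc.prod isCompact_Icc : IsCompact (Icc a b ×ˢ Icc 0 R)
    ).exists_bound_of_continuousOn hm.continuousOn
  refine ⟨|C|, abs_nonneg C, fun t r h1 h2 h3 h4 => ?_⟩
  exact (hC (t, r) ⟨⟨h1, h2⟩, ⟨h3, h4⟩⟩).trans (le_abs_self C)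

theorem hasDerivAt_multPair {m m' : ℝ → ℝ → ℝ} (hm : Continuous fun p : ℝ × ℝ => m p.1 p.2)
    (hm' : Continuous fun p : ℝ × ℝ => m' p.1 p.2)
    (hd : ∀ t r, HasDerivAt (fun τ => m τ r) (m' t r) t) (f : L2Space n)
    {φ : 𝓢(EuclideanSpace ℝ (Fin n), ℂ)} (hφ : HasCompactSupport φ) (t : ℝ) :
    HasDerivAt (fun t => multPair (m t) f φ) (multPair (m' t) f φ) t := by
  obtain ⟨R, hR0, hR⟩ := exists_freq_le hφ
  obtain ⟨C, hC0, hC⟩ := exists_bound_multiplier hm' (t - 1) (t + 1) R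
  have hmt : ∀ t, Continuous (m t) := fun t => hm.comp (by fun_prop : Continuous fun r => (t, r))
  have hmt' : ∀ t, Continuous (m' t) := fun t => hm'.comp (by fun_prop : Continuous fun r => (t, r))
  have hint : Integrable (fun ξ => C * ‖f ξ * φ ξ‖) := by
    have := integrable_multPair (m := fun _ => 1) continuous_const f hφ
    simp only [Complex.ofReal_one, one_mul] at this
    exact this.norm.const_mul C
  refine (hasDerivAt_integral_of_dominated_loc_of_deriv_le (s := Icc (t - 1) (t + 1))
    (bound := fun ξ => C * ‖f ξ * φ ξ‖) (F := fun τ ξ => ((m τ (freq ξ) : ℝ) : ℂ) * f ξ * φ ξ)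
    (F' := fun τ ξ => ((m' τ (freq ξ) : ℝ) : ℂ) * f ξ * φ ξ) (Icc_mem_nhds (by linarith) (by linarith))
    (Filter.Eventually.of_forall fun τ => (integrable_multPair (hmt τ) f hφ).aestronglyMeasurable)
    (integrable_multPair (hmt t) f hφ) (integrable_multPair (hmt' t) f hφ).aestronglyMeasurable
    (Filter.Eventually.of_forall fun ξ τ hτ => ?_) hint
    (Filter.Eventually.of_forall fun ξ τ hτ => ?_)).2
  · by_cases hξ : φ ξ = 0
    · simp [hξ]
    · rw [mul_assoc, norm_mul, Complex.norm_real, Real.norm_eq_abs]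
      gcongr
      exact hC τ _ hτ.1 hτ.2 (freq_nonneg ξ) (hR ξ hξ)
  · exact (((hd τ (freq ξ)).ofReal_comp).mul_const (f ξ)).mul_const (φ ξ)

theorem norm_multPair_iterate_le {m : ℝ → ℝ → ℝ} (hm : Continuous fun p : ℝ × ℝ => m p.1 p.2)
    (f : L2Space n) {φ : 𝓢(EuclideanSpace ℝ (Fin n), ℂ)} (hφ : HasCompactSupport φ) {R : ℝ}
    (hR : ∀ ξ, φ ξ ≠ 0 → freq ξ ≤ R) (T : ℝ) :
    ∃ M : ℝ, ∀ k t, 0 ≤ t → t ≤ T → ‖multPair (m t) f (freqSqMul^[k] φ)‖ ≤ M * (R ^ 2) ^ k := by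
  obtain ⟨C, hC0, hC⟩ := exists_bound_multiplier hm 0 T R
  have hint : Integrable (fun ξ => C * ‖f ξ * φ ξ‖) := by
    have := integrable_multPair (m := fun _ => 1) continuous_const f hφ
    simp only [Complex.ofReal_one, one_mul] at this
    exact this.norm.const_mul C
  refine ⟨∫ ξ, C * ‖f ξ * φ ξ‖, fun k t h0 hT => ?_⟩
  rw [← integral_mul_const]
  unfold multPair
  refine norm_integral_le_of_norm_le (hint.mul_const _) (Filter.Eventually.of_forall fun ξ => ?_)
  rw [freqSqMul_iterate_apply]
  by_cases hξ : φ ξ = 0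
  · simp [hξ]
  · have h1 : (freq ξ ^ 2) ^ k ≤ (R ^ 2) ^ k := by
      have := hR ξ hξ
      have := freq_nonneg ξ
      gcongr
    have h2 := hC t _ h0 hT (freq_nonneg ξ) (hR ξ hξ)
    have h3 : ‖(((freq ξ ^ 2) ^ k : ℝ) : ℂ)‖ = (freq ξ ^ 2) ^ k := by
      rw [Complex.norm_real, Real.norm_of_nonneg (by positivity)]
    rw [norm_mul, norm_mul, norm_mul, h3, Complex.norm_real, Real.norm_eq_abs, norm_mul]
    calc |m t (freq ξ)| * ‖f ξ‖ * ((freq ξ ^ 2) ^ k * ‖φ ξ‖)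
        ≤ C * ‖f ξ‖ * ((R ^ 2) ^ k * ‖φ ξ‖) := by gcongr
      _ = _ := by ring

/-- Continuity into L² bounds ‖u(t)‖ on [0,T], Plancherel transfers the bound to frequency, and on
the support of φ each power of r² costs at most R². This is how membership in C([0,∞);L²) enters
uniqueness. -/
theorem norm_fourier_iterate_le {u : ℝ → L2Space n} (hu : ContinuousOn u (Ici 0))
    {φ : 𝓢(EuclideanSpace ℝ (Fin n), ℂ)} {R : ℝ}
    (hR : ∀ ξ, φ ξ ≠ 0 → freq ξ ≤ R) (T : ℝ) :
    ∃ M : ℝ, ∀ k t, 0 ≤ t → t ≤ T →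
      ‖𝓕 (u t : TDist n) (freqSqMul^[k] φ)‖ ≤ M * (R ^ 2) ^ k := by
  obtain ⟨B, hB⟩ := (isCompact_Icc : IsCompact (Icc 0 T)).exists_bound_of_continuousOn
    (hu.mono (fun x hx => hx.1))
  have hφ2 : Integrable fun ξ => ‖φ ξ‖ ^ 2 := (φ.memLp 2 volume).integrable_norm_pow (by norm_num)
  refine ⟨((∫ ξ, ‖φ ξ‖ ^ 2) + B ^ 2) / 2, fun k t h0 hT => ?_⟩
  rw [fourier_L2_apply]
  set g : L2Space n := 𝓕 (u t)
  have hg2 : Integrable fun ξ => ‖g ξ‖ ^ 2 := (Lp.memLp g).integrable_norm_pow (by norm_num)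
  have hgn : ∫ ξ, ‖g ξ‖ ^ 2 ≤ B ^ 2 := by
    have h1 : ∫ ξ, ‖g ξ‖ ^ 2 = ‖g‖ ^ 2 := by
      have h2 := L2.inner_def (𝕜 := ℂ) g g
      rw [inner_self_eq_norm_sq_to_K] at h2
      simp only [inner_self_eq_norm_sq_to_K] at h2
      have h3 : ∫ ξ, ((‖g ξ‖ : ℂ)) ^ 2 = ((∫ ξ, ‖g ξ‖ ^ 2 : ℝ) : ℂ) := by
        rw [← integral_complex_ofReal]; simp
      simp only [Complex.coe_algebraMap] at h2
      rw [h3] at h2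
      exact_mod_cast h2.symm
    rw [h1, Lp.norm_fourier_eq]
    have := hB t ⟨h0, hT⟩
    gcongr
  have hle : ‖∫ ξ, (freqSqMul^[k] φ) ξ * g ξ‖
      ≤ ∫ ξ, (R ^ 2) ^ k * ((‖φ ξ‖ ^ 2 + ‖g ξ‖ ^ 2) / 2) := by
    refine norm_integral_le_of_norm_le (((hφ2.add hg2).div_const 2).const_mul _)
      (Filter.Eventually.of_forall fun ξ => ?_)
    rw [freqSqMul_iterate_apply]
    by_cases hξ : φ ξ = 0
    · simp only [hξ, mul_zero, zero_mul, norm_zero]; positivity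
    · have h1 : (freq ξ ^ 2) ^ k ≤ (R ^ 2) ^ k := by
        have := hR ξ hξ
        have := freq_nonneg ξ
        gcongr
      rw [norm_mul, norm_mul, Complex.norm_real, Real.norm_of_nonneg (by positivity), mul_assoc]
      gcongr
      linarith [two_mul_le_add_sq ‖φ ξ‖ ‖g ξ‖]
  refine hle.trans ?_
  rw [integral_const_mul, integral_div, integral_add hφ2 hg2, mul_comm]
  gcongr

/-! ### Defects and identification of solutions with multipliers -/

/-- The defect between the Fourier transform of `u` and `m f + k g`, tested against `φ`. -/
def defect (u : TDist n) (m k : ℝ → ℝ) (f g : L2Space n)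
    (φ : 𝓢(EuclideanSpace ℝ (Fin n), ℂ)) : ℂ :=
  𝓕 u φ - (multPair m f φ + multPair k g φ)

theorem HasTimeDeriv.defect {u u' : ℝ → TDist n} (hu : HasTimeDeriv u u') {m m' k k' : ℝ → ℝ → ℝ}
    (hm : Continuous fun p : ℝ × ℝ => m p.1 p.2) (hm' : Continuous fun p : ℝ × ℝ => m' p.1 p.2)
    (hk : Continuous fun p : ℝ × ℝ => k p.1 p.2) (hk' : Continuous fun p : ℝ × ℝ => k' p.1 p.2)
    (hmd : ∀ t r, HasDerivAt (fun τ => m τ r) (m' t r) t)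
    (hkd : ∀ t r, HasDerivAt (fun τ => k τ r) (k' t r) t) (f g : L2Space n)
    {φ : 𝓢(EuclideanSpace ℝ (Fin n), ℂ)} (hφ : HasCompactSupport φ) (t : ℝ) (ht : 0 ≤ t) :
    HasDerivWithinAt (fun t => defect (u t) (m t) (k t) f g φ)
      (defect (u' t) (m' t) (k' t) f g φ) (Ici 0) t :=
  -- Pairing 𝓕 u with φ is by definition pairing u with 𝓕 φ, so the time derivative is tested at 𝓕
  -- φ.
  (hu (𝓕 φ) t ht).sub ((hasDerivAt_multPair hm hm' hmd f hφ t).hasDerivWithinAt.add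
    (hasDerivAt_multPair hk hk' hkd g hφ t).hasDerivWithinAt)

theorem norm_defect_iterate_le {u : ℝ → L2Space n} (hu : ContinuousOn u (Ici 0))
    {m k : ℝ → ℝ → ℝ}
    (hm : Continuous fun p : ℝ × ℝ => m p.1 p.2) (hk : Continuous fun p : ℝ × ℝ => k p.1 p.2)
    (f g : L2Space n) {φ : 𝓢(EuclideanSpace ℝ (Fin n), ℂ)} (hφ : HasCompactSupport φ) (T : ℝ) :
    ∃ M R : ℝ, ∀ j t, 0 ≤ t → t ≤ T →
      ‖defect (u t) (m t) (k t) f g (freqSqMul^[j] φ)‖ ≤ M * R ^ j := by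
  obtain ⟨R, hR0, hR⟩ := exists_freq_le hφ
  obtain ⟨M1, h1⟩ := norm_fourier_iterate_le hu hR T
  obtain ⟨M2, h2⟩ := norm_multPair_iterate_le hm f hφ hR T
  obtain ⟨M3, h3⟩ := norm_multPair_iterate_le hk g hφ hR T
  refine ⟨M1 + (M2 + M3), R ^ 2, fun j t h0 hT => ?_⟩
  refine (norm_sub_le _ _).trans ((add_le_add (h1 j t h0 hT) ((norm_add_le _ _).trans
    (add_le_add (h2 j t h0 hT) (h3 j t h0 hT)))).trans (le_of_eq (by ring)))

/-- Identification of the solution of a third-order equation with its Fourier representation. -/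
theorem defect_eq_zero_of_third_order {u : ℝ → L2Space n} (hu : ContinuousOn u (Ici 0))
    {u1 u2 u3 : ℝ → TDist n} (h01 : HasTimeDeriv (fun t => (u t : TDist n)) u1)
    (h12 : HasTimeDeriv u1 u2) (h23 : HasTimeDeriv u2 u3)
    {m m1 m2 m3 k k1 k2 k3 : ℝ → ℝ → ℝ}
    (hm : Continuous fun p : ℝ × ℝ => m p.1 p.2) (hm1 : Continuous fun p : ℝ × ℝ => m1 p.1 p.2)
    (hm2 : Continuous fun p : ℝ × ℝ => m2 p.1 p.2) (hm3 : Continuous fun p : ℝ × ℝ => m3 p.1 p.2)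
    (hk : Continuous fun p : ℝ × ℝ => k p.1 p.2) (hk1 : Continuous fun p : ℝ × ℝ => k1 p.1 p.2)
    (hk2 : Continuous fun p : ℝ × ℝ => k2 p.1 p.2) (hk3 : Continuous fun p : ℝ × ℝ => k3 p.1 p.2)
    (m01 : ∀ t r, HasDerivAt (fun τ => m τ r) (m1 t r) t)
    (m12 : ∀ t r, HasDerivAt (fun τ => m1 τ r) (m2 t r) t)
    (m23 : ∀ t r, HasDerivAt (fun τ => m2 τ r) (m3 t r) t)
    (k01 : ∀ t r, HasDerivAt (fun τ => k τ r) (k1 t r) t)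
    (k12 : ∀ t r, HasDerivAt (fun τ => k1 τ r) (k2 t r) t)
    (k23 : ∀ t r, HasDerivAt (fun τ => k2 τ r) (k3 t r) t) {f g : L2Space n} {c1 c2 c3 c4 : ℂ}
    (heq : ∀ t, 0 ≤ t → ∀ φ : 𝓢(EuclideanSpace ℝ (Fin n), ℂ), HasCompactSupport φ →
      defect (u3 t) (m3 t) (k3 t) f g φ = -(c1 * defect (u2 t) (m2 t) (k2 t) f g (freqSqMul φ)
        + c2 * defect (u1 t) (m1 t) (k1 t) f g (freqSqMul φ)
        + c3 * defect (u1 t) (m1 t) (k1 t) f g (freqSqMul (freqSqMul φ))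
        + c4 * defect (u t) (m t) (k t) f g (freqSqMul (freqSqMul φ))))
    (z0 : ∀ φ : 𝓢(EuclideanSpace ℝ (Fin n), ℂ), HasCompactSupport φ →
      defect (u 0) (m 0) (k 0) f g φ = 0)
    (z1 : ∀ φ : 𝓢(EuclideanSpace ℝ (Fin n), ℂ), HasCompactSupport φ →
      defect (u1 0) (m1 0) (k1 0) f g φ = 0)
    (z2 : ∀ φ : 𝓢(EuclideanSpace ℝ (Fin n), ℂ), HasCompactSupport φ →
      defect (u2 0) (m2 0) (k2 0) f g φ = 0)
    (t : ℝ) (ht : 0 ≤ t) (φ : 𝓢(EuclideanSpace ℝ (Fin n), ℂ)) (hφ : HasCompactSupport φ) :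
    defect (u t) (m t) (k t) f g φ = 0 := by
  have hS := hasCompactSupport_freqSqMul_iterate hφ
  have d01 := fun j t ht => h01.defect hm hm1 hk hk1 m01 k01 f g (hS j) t ht
  have d12 := fun j t ht => h12.defect hm1 hm2 hk1 hk2 m12 k12 f g (hS j) t ht
  have d23 := fun j t ht => h23.defect hm2 hm3 hk2 hk3 m23 k23 f g (hS j) t ht
  have heq' := fun j t ht => heq t ht _ (hS j)
  have e0 := fun j => z0 _ (hS j)
  have e1 := fun j => z1 _ (hS j)
  have e2 := fun j => z2 _ (hS j)
  have hb := norm_defect_iterate_le hu hm hk f g hφ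
  simp only [← Function.iterate_succ_apply' freqSqMul] at heq'
  set D0 : ℕ → ℝ → ℂ := fun j t => defect (u t) (m t) (k t) f g (freqSqMul^[j] φ) with hD0
  set D1 : ℕ → ℝ → ℂ := fun j t => defect (u1 t) (m1 t) (k1 t) f g (freqSqMul^[j] φ) with hD1
  set D2 : ℕ → ℝ → ℂ := fun j t => defect (u2 t) (m2 t) (k2 t) f g (freqSqMul^[j] φ) with hD2
  have key : D0 0 t = 0 := hierarchy_eq_zero (D0 := D0) (D1 := D1) (D2 := D2)
    (c1 := c1) (c2 := c2) (c3 := c3) (c4 := c4) d01 d12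
    (fun j t ht => (d23 j t ht).congr_deriv (heq' j t ht)) e0 e1 e2 hb 0 t ht
  exact key

/-- Identification of the solution of a second-order equation with its Fourier representation. -/
theorem defect_eq_zero_of_second_order {u : ℝ → L2Space n} (hu : ContinuousOn u (Ici 0))
    {u1 u2 : ℝ → TDist n} (h01 : HasTimeDeriv (fun t => (u t : TDist n)) u1)
    (h12 : HasTimeDeriv u1 u2) {m m1 m2 k k1 k2 : ℝ → ℝ → ℝ}
    (hm : Continuous fun p : ℝ × ℝ => m p.1 p.2) (hm1 : Continuous fun p : ℝ × ℝ => m1 p.1 p.2)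
    (hm2 : Continuous fun p : ℝ × ℝ => m2 p.1 p.2)
    (hk : Continuous fun p : ℝ × ℝ => k p.1 p.2) (hk1 : Continuous fun p : ℝ × ℝ => k1 p.1 p.2)
    (hk2 : Continuous fun p : ℝ × ℝ => k2 p.1 p.2)
    (m01 : ∀ t r, HasDerivAt (fun τ => m τ r) (m1 t r) t)
    (m12 : ∀ t r, HasDerivAt (fun τ => m1 τ r) (m2 t r) t)
    (k01 : ∀ t r, HasDerivAt (fun τ => k τ r) (k1 t r) t)
    (k12 : ∀ t r, HasDerivAt (fun τ => k1 τ r) (k2 t r) t) {f g : L2Space n} {c : ℂ}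
    (heq : ∀ t, 0 ≤ t → ∀ φ : 𝓢(EuclideanSpace ℝ (Fin n), ℂ), HasCompactSupport φ →
      defect (u2 t) (m2 t) (k2 t) f g φ = -(c * defect (u1 t) (m1 t) (k1 t) f g (freqSqMul φ)
        + defect (u t) (m t) (k t) f g (freqSqMul φ)))
    (z0 : ∀ φ : 𝓢(EuclideanSpace ℝ (Fin n), ℂ), HasCompactSupport φ →
      defect (u 0) (m 0) (k 0) f g φ = 0)
    (z1 : ∀ φ : 𝓢(EuclideanSpace ℝ (Fin n), ℂ), HasCompactSupport φ →
      defect (u1 0) (m1 0) (k1 0) f g φ = 0)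
    (t : ℝ) (ht : 0 ≤ t) (φ : 𝓢(EuclideanSpace ℝ (Fin n), ℂ)) (hφ : HasCompactSupport φ) :
    defect (u t) (m t) (k t) f g φ = 0 ∧ defect (u1 t) (m1 t) (k1 t) f g φ = 0 := by
  have hS := hasCompactSupport_freqSqMul_iterate hφ
  have d01 := fun j t ht => h01.defect hm hm1 hk hk1 m01 k01 f g (hS j) t ht
  have d12 := fun j t ht => h12.defect hm1 hm2 hk1 hk2 m12 k12 f g (hS j) t ht
  have heq' := fun j t ht => heq t ht _ (hS j)
  have e0 := fun j => z0 _ (hS j)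
  have e1 := fun j => z1 _ (hS j)
  have hb := norm_defect_iterate_le hu hm hk f g hφ
  simp only [← Function.iterate_succ_apply' freqSqMul] at heq'
  set D0 : ℕ → ℝ → ℂ := fun j t => defect (u t) (m t) (k t) f g (freqSqMul^[j] φ) with hD0
  set D1 : ℕ → ℝ → ℂ := fun j t => defect (u1 t) (m1 t) (k1 t) f g (freqSqMul^[j] φ) with hD1
  set D2 : ℕ → ℝ → ℂ := fun j t => defect (u2 t) (m2 t) (k2 t) f g (freqSqMul^[j] φ) with hD2
  have h2 : ∀ j t, 0 ≤ t → D2 j t = -(c * D1 (j + 1) t + D0 (j + 1) t) := heq'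
  -- The equation expresses D2 through differentiable functions, so it can be differentiated once
  -- more and falls under the third-order hierarchy with c3 = c4 = 0. The initial value of D2
  -- vanishes by the equation at t = 0.
  have key : ∀ t, 0 ≤ t → D0 0 t = 0 := hierarchy_eq_zero (D0 := D0) (D1 := D1) (D2 := D2)
    (c1 := c) (c2 := 1) (c3 := 0) (c4 := 0) d01 d12
    (fun j t ht => by
      have h := (((d12 (j + 1) t ht).const_mul c).add (d01 (j + 1) t ht)).neg
      refine (h.congr (fun s hs => h2 j s hs) (h2 j t ht)).congr_deriv ?_
      simp only [hD0, hD1, hD2]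
      ring)
    e0 e1 (fun j => by
      have a0 : D0 (j + 1) 0 = 0 := e0 (j + 1)
      have a1 : D1 (j + 1) 0 = 0 := e1 (j + 1)
      rw [h2 j 0 le_rfl, a0, a1]; simp) hb 0
  -- D0 vanishes on the whole half-line, so its one-sided derivative vanishes too, including at t =
  -- 0.
  have h3 : HasDerivWithinAt (D0 0) (D1 0 t) (Ici 0) t := d01 0 t ht
  have h4 : HasDerivWithinAt (D0 0) 0 (Ici 0) t :=
    (hasDerivWithinAt_const t (Ici 0) (0 : ℂ)).congr (fun s hs => key s hs) (key t ht)
  have h5 : D1 0 t = 0 := ((uniqueDiffOn_Ici (0 : ℝ)) t ht).eq_deriv _ h3 h4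
  exact ⟨key t ht, h5⟩

/-- Vanishing defect means that the Fourier transform is given by the multipliers. -/
theorem fourier_ae_eq_of_defect {u : L2Space n} {m k : ℝ → ℝ} (hm : Continuous m)
    (hk : Continuous k) {f g : L2Space n}
    (h : ∀ φ : 𝓢(EuclideanSpace ℝ (Fin n), ℂ), HasCompactSupport φ → defect u m k f g φ = 0) :
    ∀ᵐ ξ, (𝓕 u : L2Space n) ξ = ((m (freq ξ) : ℝ) : ℂ) * f ξ + ((k (freq ξ) : ℝ) : ℂ) * g ξ := by
  have hli : ∀ (m : ℝ → ℝ) (_ : Continuous m) (f : L2Space n),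
      LocallyIntegrable (fun ξ => ((m (freq ξ) : ℝ) : ℂ) * f ξ) volume := fun m hm f => by
    have h1 := (locallyIntegrable_L2 f).locallyIntegrableOn univ
    rw [← locallyIntegrableOn_univ]
    exact h1.continuousOn_mul (Complex.continuous_ofReal.comp (hm.comp continuous_freq)).continuousOn
      isOpen_univ.isLocallyClosed
  have hz : ∀ᵐ ξ, (𝓕 u : L2Space n) ξ
      - (((m (freq ξ) : ℝ) : ℂ) * f ξ + ((k (freq ξ) : ℝ) : ℂ) * g ξ) = 0 := by
    apply ae_eq_zero_of_integral_contDiff_smul_eq_zero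
    · exact (locallyIntegrable_L2 _).sub ((hli m hm f).add (hli k hk g))
    · intro φ hφ hφc
      -- A real bump function is a compactly supported Schwartz function, so the fundamental lemma
      -- of the calculus of variations applies.
      have hc1 : HasCompactSupport (Complex.ofRealCLM ∘ φ) := hφc.comp_left rfl
      have hc2 : ContDiff ℝ (⊤ : ℕ∞) (Complex.ofRealCLM ∘ φ) := by fun_prop
      set Φ := hc1.toSchwartzMap hc2 with hΦ
      have hΦa : ∀ ξ, Φ ξ = (φ ξ : ℂ) := fun ξ => rfl
      have hΦc : HasCompactSupport Φ := hc1
      have h1 := h Φ hΦc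
      unfold defect at h1
      rw [fourier_L2_apply] at h1
      have i1 : Integrable fun ξ => Φ ξ * (𝓕 u : L2Space n) ξ := by
        have := integrable_multPair (m := fun _ => 1) continuous_const (𝓕 u : L2Space n) hΦc
        simp only [Complex.ofReal_one, one_mul] at this
        exact this.congr (Filter.Eventually.of_forall fun ξ => mul_comm _ _)
      have i2 := integrable_multPair hm f hΦc
      have i3 := integrable_multPair hk g hΦc
      unfold multPair at h1
      have i4 := i2.add i3
      rw [← integral_add i2 i3] at h1
      have h2 := integral_sub i1 i4
      simp only [Pi.add_apply] at h2
      rw [h1] at h2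
      rw [← h2]
      congr 1
      ext ξ
      rw [hΦa, Complex.real_smul]
      ring
  filter_upwards [hz] with ξ hξ
  exact sub_eq_zero.1 hξ

/-! ### Fourier representation of the three solutions -/

/-- A family of modes with data `(α, β)`, depending continuously on the frequency. -/
structure ModeFamily (a γ κ α β : ℝ) where
  u : ℝ → ℝ → ℝ
  u1 : ℝ → ℝ → ℝ
  u2 : ℝ → ℝ → ℝ
  z : ℝ → ℝ → ℝ
  z1 : ℝ → ℝ → ℝ
  w : ℝ → ℝ → ℝ
  w1 : ℝ → ℝ → ℝ
  system : ∀ r, IsModeSystem a γ κ r α β (fun t => u t r) (fun t => u1 t r) (fun t => u2 t r)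
    (fun t => z t r) (fun t => z1 t r) (fun t => w t r) (fun t => w1 t r)
  cont_u : Continuous fun p : ℝ × ℝ => u p.1 p.2
  cont_u1 : Continuous fun p : ℝ × ℝ => u1 p.1 p.2
  cont_u2 : Continuous fun p : ℝ × ℝ => u2 p.1 p.2
  cont_z : Continuous fun p : ℝ × ℝ => z p.1 p.2
  cont_z1 : Continuous fun p : ℝ × ℝ => z1 p.1 p.2
  cont_w : Continuous fun p : ℝ × ℝ => w p.1 p.2
  cont_w1 : Continuous fun p : ℝ × ℝ => w1 p.1 p.2

theorem nonempty_modeFamily (a γ κ α β : ℝ) : Nonempty (ModeFamily a γ κ α β) := by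
  obtain ⟨u, u1, u2, z, z1, w, w1, hs, c1, c2, c3, c4, c5, c6, c7⟩ :=
    exists_modeSystem a γ κ (fun _ => α) (fun _ => β) continuous_const continuous_const
  exact ⟨⟨u, u1, u2, z, z1, w, w1, hs, c1, c2, c3, c4, c5, c6, c7⟩⟩

theorem fourier_sub_apply' (x y : TDist n) (φ : 𝓢(EuclideanSpace ℝ (Fin n), ℂ)) :
    𝓕 (x - y) φ = 𝓕 x φ - 𝓕 y φ := rfl

theorem fourier_add_apply' (x y : TDist n) (φ : 𝓢(EuclideanSpace ℝ (Fin n), ℂ)) :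
    𝓕 (x + y) φ = 𝓕 x φ + 𝓕 y φ := rfl

theorem fourier_smul_apply' (c : ℂ) (x : TDist n) (φ : 𝓢(EuclideanSpace ℝ (Fin n), ℂ)) :
    𝓕 (c • x) φ = c * 𝓕 x φ := rfl

theorem fourier_zero_apply' (φ : 𝓢(EuclideanSpace ℝ (Fin n), ℂ)) :
    𝓕 (0 : TDist n) φ = 0 := rfl

theorem Continuous.slice {m : ℝ → ℝ → ℝ} (hm : Continuous fun p : ℝ × ℝ => m p.1 p.2) (t : ℝ) :
    Continuous (m t) := hm.comp (by fun_prop : Continuous fun r => (t, r))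

/-- Powers of r in the mode equation become applications of `freqSqMul` to the test function, which
matches the transformed Laplacians in the distributional equation. -/
theorem multPair_third_order {m0 m1 m2 : ℝ → ℝ} (h0 : Continuous m0) (h1 : Continuous m1)
    (h2 : Continuous m2) (A B D : ℝ) (f : L2Space n) {φ : 𝓢(EuclideanSpace ℝ (Fin n), ℂ)}
    (hφ : HasCompactSupport φ) :
    multPair (fun r => -(A * r ^ 2) * m2 r - (r ^ 2 + B * r ^ 4) * m1 r - D * r ^ 4 * m0 r) f φ
      = -(A * multPair m2 f (freqSqMul φ) + multPair m1 f (freqSqMul φ)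
        + B * multPair m1 f (freqSqMul (freqSqMul φ))
        + D * multPair m0 f (freqSqMul (freqSqMul φ))) := by
  have e : (fun r => -(A * r ^ 2) * m2 r - (r ^ 2 + B * r ^ 4) * m1 r - D * r ^ 4 * m0 r)
      = fun r => (-A) * (r ^ 2 * m2 r) + ((-1) * (r ^ 2 * m1 r)
        + ((-B) * (r ^ 2 * (r ^ 2 * m1 r)) + (-D) * (r ^ 2 * (r ^ 2 * m0 r)))) := by
    funext r; ring
  rw [e, multPair_add (by fun_prop) (by fun_prop) _ hφ, multPair_add (by fun_prop) (by fun_prop) _ hφ,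
    multPair_add (by fun_prop) (by fun_prop) _ hφ, multPair_const_mul, multPair_const_mul,
    multPair_const_mul, multPair_const_mul, multPair_sq_mul, multPair_sq_mul,
    multPair_sq_mul (fun r => r ^ 2 * m1 r), multPair_sq_mul (fun r => r ^ 2 * m0 r),
    multPair_sq_mul, multPair_sq_mul]
  push_cast; ring

theorem multPair_second_order {m0 m1 k0 k1 : ℝ → ℝ} (h0 : Continuous m0) (h1 : Continuous m1)
    (h2 : Continuous k0) (h3 : Continuous k1) (a g : ℝ) (f : L2Space n)
    {φ : 𝓢(EuclideanSpace ℝ (Fin n), ℂ)} (hφ : HasCompactSupport φ) :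
    multPair (fun r => -r ^ 2 * m0 r - a * r ^ 2 * m1 r - g * r ^ 2 * (k1 r + a * r ^ 2 * k0 r)) f φ
      = -(multPair m0 f (freqSqMul φ) + a * multPair m1 f (freqSqMul φ)
        + g * (multPair k1 f (freqSqMul φ) + a * multPair k0 f (freqSqMul (freqSqMul φ)))) := by
  have e : (fun r => -r ^ 2 * m0 r - a * r ^ 2 * m1 r - g * r ^ 2 * (k1 r + a * r ^ 2 * k0 r))
      = fun r => (-1) * (r ^ 2 * m0 r) + ((-a) * (r ^ 2 * m1 r)
        + ((-g) * (r ^ 2 * k1 r) + (-(g * a)) * (r ^ 2 * (r ^ 2 * k0 r)))) := by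
    funext r; ring
  rw [e, multPair_add (by fun_prop) (by fun_prop) _ hφ, multPair_add (by fun_prop) (by fun_prop) _ hφ,
    multPair_add (by fun_prop) (by fun_prop) _ hφ, multPair_const_mul, multPair_const_mul,
    multPair_const_mul, multPair_const_mul, multPair_sq_mul, multPair_sq_mul,
    multPair_sq_mul, multPair_sq_mul (fun r => r ^ 2 * k0 r), multPair_sq_mul]
  push_cast; ring

theorem fourier_L2_eq_multPair (f : L2Space n) (φ : 𝓢(EuclideanSpace ℝ (Fin n), ℂ)) :
    𝓕 (f : TDist n) φ = multPair (fun _ => 1) (𝓕 f) φ := by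
  rw [fourier_L2_apply]
  unfold multPair
  congr 1; ext ξ; simp [mul_comm]

theorem multPair_zero (f : L2Space n) (φ : 𝓢(EuclideanSpace ℝ (Fin n), ℂ)) :
    multPair (fun _ => 0) f φ = 0 := by
  simp [multPair]

variable {b ν γ κ : ℝ}

/-- Fourier representation of the solution of the Blackstock equation. -/
theorem blackstock_fourier {a : ℝ} (ha : a = b * ν) {ψ₀ ψ₁ : L2Space n} {ψ₂ : TDist n} {ψ : ℝ → L2Space n}
    (h2 : ψ₂ = ((b * ν : ℝ) : ℂ) • Δ (ψ₁ : TDist n) + Δ (ψ₀ : TDist n))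
    (h : IsBlackstockSolution b ν γ κ (ψ₀ : TDist n) (ψ₁ : TDist n) ψ₂ ψ)
    (M : ModeFamily a γ κ 1 0) (N : ModeFamily a γ κ 0 1) (t : ℝ) (ht : 0 ≤ t) :
    ∀ᵐ ξ, (𝓕 (ψ t) : L2Space n) ξ = ((M.u t (freq ξ) : ℝ) : ℂ) * (𝓕 ψ₀ : L2Space n) ξ
      + ((N.u t (freq ξ) : ℝ) : ℂ) * (𝓕 ψ₁ : L2Space n) ξ := by
  obtain ⟨hc, u1, u2, u3, h01, h12, h23, heq, i0, i1, i2⟩ := h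
  simp only [← ha] at heq h2
  refine fourier_ae_eq_of_defect (M.cont_u.slice t) (N.cont_u.slice t) fun φ hφ => ?_
  have c3 : ∀ {α β : ℝ} (F : ModeFamily a γ κ α β), Continuous fun p : ℝ × ℝ =>
      -((a + γ * κ) * p.2 ^ 2) * F.u2 p.1 p.2 - (p.2 ^ 2 + γ * a * κ * p.2 ^ 4) * F.u1 p.1 p.2
        - κ * p.2 ^ 4 * F.u p.1 p.2 := fun F => by
    have := F.cont_u
    have := F.cont_u1
    have := F.cont_u2
    fun_prop
  refine defect_eq_zero_of_third_order hc h01 h12 h23 M.cont_u M.cont_u1 M.cont_u2 (c3 M)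
    N.cont_u N.cont_u1 N.cont_u2 (c3 N) (fun t r => (M.system r).u_deriv t)
    (fun t r => (M.system r).u1_deriv t) (fun t r => (M.system r).u2_deriv t)
    (fun t r => (N.system r).u_deriv t) (fun t r => (N.system r).u1_deriv t)
    (fun t r => (N.system r).u2_deriv t) (c1 := ((a + γ * κ : ℝ) : ℂ)) (c2 := 1)
    (c3 := ((γ * a * κ : ℝ) : ℂ)) (c4 := (κ : ℂ)) ?_ ?_ ?_ ?_ t ht φ hφ
  · intro t ht φ hφ
    -- The operator expands to the cubic's coefficients: δ + κ = a + γκ and κδ + κ(γ-1)(a-κ) = γaκ.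
    have h3 := congrArg (fun T : TDist n => 𝓕 T φ) (heq t ht)
    simp only [fourier_sub_apply', fourier_add_apply', fourier_smul_apply', fourier_zero_apply',
      fourier_laplacian_apply] at h3
    unfold defect
    rw [multPair_third_order (M.cont_u.slice t) (M.cont_u1.slice t) (M.cont_u2.slice t) _ _ _ _ hφ,
      multPair_third_order (N.cont_u.slice t) (N.cont_u1.slice t) (N.cont_u2.slice t) _ _ _ _ hφ]
    push_cast at h3 ⊢
    linear_combination h3
  · intro φ hφ
    have e1 : M.u 0 = fun _ => 1 := funext fun r => (M.system r).u_zero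
    have e2 : N.u 0 = fun _ => 0 := funext fun r => (N.system r).u_zero
    unfold defect
    rw [i0, e1, e2, multPair_zero, fourier_L2_eq_multPair]; ring
  · intro φ hφ
    have e1 : M.u1 0 = fun _ => 0 := funext fun r => (M.system r).u1_zero
    have e2 : N.u1 0 = fun _ => 1 := funext fun r => (N.system r).u1_zero
    unfold defect
    rw [i1, e1, e2, multPair_zero, fourier_L2_eq_multPair]; ring
  · intro φ hφ
    have e1 : M.u2 0 = fun r => (-1) * (r ^ 2 * 1) := funext fun r => by
      rw [(M.system r).u2_zero]; ring
    have e2 : N.u2 0 = fun r => (-a) * (r ^ 2 * 1) := funext fun r => by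
      rw [(N.system r).u2_zero]; ring
    unfold defect
    rw [i2, h2, e1, e2, multPair_const_mul, multPair_const_mul, multPair_sq_mul, multPair_sq_mul,
      fourier_add_apply', fourier_smul_apply', fourier_laplacian_apply, fourier_laplacian_apply,
      fourier_L2_eq_multPair, fourier_L2_eq_multPair]
    push_cast; ring

/-- Fourier representation of the leading viscoelastic profile and of its time derivative. -/
theorem viscoelastic_defect {a : ℝ} {ψ₀ ψ₁ : L2Space n} {v : ℝ → L2Space n} {vt : ℝ → TDist n}
    (h : IsViscoelasticSolution a (ψ₀ : TDist n) (ψ₁ : TDist n) (fun _ => 0) v vt)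
    (M : ModeFamily a γ κ 1 0) (N : ModeFamily a γ κ 0 1) (t : ℝ) (ht : 0 ≤ t)
    (φ : 𝓢(EuclideanSpace ℝ (Fin n), ℂ)) (hφ : HasCompactSupport φ) :
    defect (v t) (M.z t) (N.z t) (𝓕 ψ₀) (𝓕 ψ₁) φ = 0 ∧
      defect (vt t) (M.z1 t) (N.z1 t) (𝓕 ψ₀) (𝓕 ψ₁) φ = 0 := by
  obtain ⟨hc, h01, ⟨u2, h12, heq⟩, i0, i1⟩ := h
  have c2 : ∀ {α β : ℝ} (F : ModeFamily a γ κ α β), Continuous fun p : ℝ × ℝ =>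
      -p.2 ^ 2 * F.z p.1 p.2 - a * p.2 ^ 2 * F.z1 p.1 p.2 := fun F => by
    have := F.cont_z
    have := F.cont_z1
    fun_prop
  refine defect_eq_zero_of_second_order hc h01 h12 M.cont_z M.cont_z1 (c2 M)
    N.cont_z N.cont_z1 (c2 N) (fun t r => (M.system r).z_deriv t)
    (fun t r => (M.system r).z1_deriv t) (fun t r => (N.system r).z_deriv t)
    (fun t r => (N.system r).z1_deriv t) (c := (a : ℂ)) ?_ ?_ ?_ t ht φ hφ
  · intro t ht φ hφ
    have h3 := congrArg (fun T : TDist n => 𝓕 T φ) (heq t ht)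
    simp only [fourier_sub_apply', fourier_smul_apply', fourier_zero_apply',
      fourier_laplacian_apply] at h3
    have e := fun {α β : ℝ} (F : ModeFamily a γ κ α β) (f : L2Space n) =>
      multPair_second_order (F.cont_z.slice t) (F.cont_z1.slice t) (F.cont_z.slice t)
        (F.cont_z1.slice t) a 0 f hφ
    simp only [zero_mul, sub_zero, Complex.ofReal_zero, add_zero] at e
    unfold defect
    rw [e M, e N]
    linear_combination h3
  · intro φ hφ
    have e1 : M.z 0 = fun _ => 1 := funext fun r => (M.system r).z_zero
    have e2 : N.z 0 = fun _ => 0 := funext fun r => (N.system r).z_zero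
    unfold defect
    rw [i0, e1, e2, multPair_zero, fourier_L2_eq_multPair]; ring
  · intro φ hφ
    have e1 : M.z1 0 = fun _ => 0 := funext fun r => (M.system r).z1_zero
    have e2 : N.z1 0 = fun _ => 1 := funext fun r => (N.system r).z1_zero
    unfold defect
    rw [i1, e1, e2, multPair_zero, fourier_L2_eq_multPair]; ring

/-- Fourier representation of the first corrector. -/
theorem corrector_fourier {a : ℝ} {ψ₀ ψ₁ : L2Space n} {v w : ℝ → L2Space n} {vt wt : ℝ → TDist n}
    (h : IsViscoelasticSolution a (ψ₀ : TDist n) (ψ₁ : TDist n) (fun _ => 0) v vt)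
    (hw : IsViscoelasticSolution a
      (((1 - γ : ℝ) : ℂ) • ((ψ₁ : TDist n) - (a : ℂ) • Δ (ψ₀ : TDist n))) 0
      (fun t => ((γ - 1 : ℝ) : ℂ) • Δ (vt t - (a : ℂ) • Δ (v t : TDist n))) w wt)
    (M : ModeFamily a γ κ 1 0) (N : ModeFamily a γ κ 0 1) (t : ℝ) (ht : 0 ≤ t) :
    ∀ᵐ ξ, (𝓕 (w t) : L2Space n) ξ = ((M.w t (freq ξ) : ℝ) : ℂ) * (𝓕 ψ₀ : L2Space n) ξ
      + ((N.w t (freq ξ) : ℝ) : ℂ) * (𝓕 ψ₁ : L2Space n) ξ := by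
  have hz := viscoelastic_defect h M N
  obtain ⟨hc, h01, ⟨u2, h12, heq⟩, i0, i1⟩ := hw
  refine fourier_ae_eq_of_defect (M.cont_w.slice t) (N.cont_w.slice t) fun φ hφ => ?_
  have c2 : ∀ {α β : ℝ} (F : ModeFamily a γ κ α β), Continuous fun p : ℝ × ℝ =>
      -p.2 ^ 2 * F.w p.1 p.2 - a * p.2 ^ 2 * F.w1 p.1 p.2
        - (γ - 1) * p.2 ^ 2 * (F.z1 p.1 p.2 + a * p.2 ^ 2 * F.z p.1 p.2) := fun F => by
    have := F.cont_z
    have := F.cont_z1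
    have := F.cont_w
    have := F.cont_w1
    fun_prop
  refine (defect_eq_zero_of_second_order hc h01 h12 M.cont_w M.cont_w1 (c2 M)
    N.cont_w N.cont_w1 (c2 N) (fun t r => (M.system r).w_deriv t)
    (fun t r => (M.system r).w1_deriv t) (fun t r => (N.system r).w_deriv t)
    (fun t r => (N.system r).w1_deriv t) (c := (a : ℂ)) ?_ ?_ ?_ t ht φ hφ).1
  · intro t ht φ hφ
    have h3 := congrArg (fun T : TDist n => 𝓕 T φ) (heq t ht)
    simp only [fourier_sub_apply', fourier_smul_apply', fourier_laplacian_apply] at h3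
    -- The source contains Δ of the time derivative and Δ² of the leading profile, so their
    -- vanishing defects are used at once- and twice-multiplied test functions.
    have hS := hasCompactSupport_freqSqMul hφ
    have z1 := (hz t ht _ hS).2
    have z0 := (hz t ht _ (hasCompactSupport_freqSqMul hS)).1
    unfold defect at z0 z1 ⊢
    rw [multPair_second_order (M.cont_w.slice t) (M.cont_w1.slice t) (M.cont_z.slice t)
        (M.cont_z1.slice t) a (γ - 1) _ hφ,
      multPair_second_order (N.cont_w.slice t) (N.cont_w1.slice t) (N.cont_z.slice t)
        (N.cont_z1.slice t) a (γ - 1) _ hφ]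
    push_cast at h3 ⊢
    linear_combination h3 - ((γ : ℂ) - 1) * z1 - ((γ : ℂ) - 1) * (a : ℂ) * z0
  · intro φ hφ
    have e1 : M.w 0 = fun r => ((1 - γ) * a) * (r ^ 2 * 1) := funext fun r => by
      rw [(M.system r).w_zero]; ring
    have e2 : N.w 0 = fun _ => (1 - γ) * 1 := funext fun r => by
      rw [(N.system r).w_zero]; ring
    unfold defect
    rw [i0, e1, e2, multPair_const_mul, multPair_sq_mul, multPair_const_mul (1 - γ) (fun _ => 1),
      fourier_smul_apply', fourier_sub_apply', fourier_smul_apply', fourier_laplacian_apply,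
      fourier_L2_eq_multPair, fourier_L2_eq_multPair]
    push_cast; ring
  · intro φ hφ
    have e1 : M.w1 0 = fun _ => 0 := funext fun r => (M.system r).w1_zero
    have e2 : N.w1 0 = fun _ => 0 := funext fun r => (N.system r).w1_zero
    unfold defect
    rw [i1, e1, e2, multPair_zero, multPair_zero, fourier_zero_apply']; ring

/-! ### The heat layer and its datum on the Fourier side -/

theorem integral_fourier_mul_eq {f g : EuclideanSpace ℝ (Fin n) → ℂ} (hf : Integrable f)
    (hg : Integrable g) : ∫ ξ, 𝓕 f ξ * g ξ = ∫ x, f x * 𝓕 g x := by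
  simpa using! VectorFourier.integral_fourierIntegral_smul_eq_flip (L := innerₗ _)
    Real.continuous_fourierChar continuous_inner hf hg

theorem integral_fourierInv_mul_eq {f g : EuclideanSpace ℝ (Fin n) → ℂ} (hf : Integrable f)
    (hg : Integrable g) : ∫ ξ, 𝓕⁻ f ξ * g ξ = ∫ x, f x * 𝓕⁻ g x := by
  have h := integral_fourier_mul_eq hf (hg.comp_neg)
  rw [← Real.fourierInv_eq_fourier_comp_neg] at h
  rw [← h, ← integral_neg_eq_self]
  simp [Real.fourierInv_eq_fourier_neg]

theorem continuous_fourier_of_integrable {f : EuclideanSpace ℝ (Fin n) → ℂ} (hf : Integrable f) :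
    Continuous (𝓕 f) :=
  VectorFourier.fourierIntegral_continuous Real.continuous_fourierChar continuous_inner hf

theorem norm_fourier_le_integral_norm (f : EuclideanSpace ℝ (Fin n) → ℂ)
    (ξ : EuclideanSpace ℝ (Fin n)) : ‖𝓕 f ξ‖ ≤ ∫ x, ‖f x‖ :=
  VectorFourier.norm_fourierIntegral_le_integral_norm _ _ _ _ _

/-- An `L²` function is determined by its pairings with test functions. -/
theorem ae_eq_of_forall_integral_schwartz_mul_eq {f : L2Space n}
    {g : EuclideanSpace ℝ (Fin n) → ℂ} (hg : LocallyIntegrable g)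
    (h : ∀ φ : 𝓢(EuclideanSpace ℝ (Fin n), ℂ), ∫ ξ, φ ξ * f ξ = ∫ ξ, φ ξ * g ξ) :
    f =ᵐ[volume] g := by
  refine ae_eq_of_integral_contDiff_smul_eq (locallyIntegrable_L2 f) hg fun φ hφ hφc => ?_
  have hc1 : HasCompactSupport (Complex.ofRealCLM ∘ φ) := hφc.comp_left rfl
  have hc2 : ContDiff ℝ (⊤ : ℕ∞) (Complex.ofRealCLM ∘ φ) := by fun_prop
  simpa using! h (hc1.toSchwartzMap hc2)

/-- On L¹ ∩ L² the Plancherel extension and the Fourier integral have the same pairings with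
Schwartz functions, by duality, hence agree almost everywhere. -/
theorem fourier_toLp_ae_eq {f : EuclideanSpace ℝ (Fin n) → ℂ} (h1 : Integrable f)
    (h2 : MemLp f 2) : (𝓕 (h2.toLp f) : L2Space n) =ᵐ[volume] 𝓕 f := by
  refine ae_eq_of_forall_integral_schwartz_mul_eq
    (continuous_fourier_of_integrable h1).locallyIntegrable fun φ => ?_
  rw [← fourier_L2_apply, TemperedDistribution.fourier_apply, Lp.toTemperedDistribution_apply,
    ← integral_fourier_mul_eq φ.integrable h1]
  refine integral_congr_ae ?_
  filter_upwards [h2.coeFn_toLp] with x hx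
  rw [hx, smul_eq_mul, SchwartzMap.fourier_coe]

theorem fourierInv_toLp_ae_eq {f : EuclideanSpace ℝ (Fin n) → ℂ} (h1 : Integrable f)
    (h2 : MemLp f 2) : (𝓕⁻ (h2.toLp f) : L2Space n) =ᵐ[volume] 𝓕⁻ f := by
  refine ae_eq_of_forall_integral_schwartz_mul_eq ?_ fun φ => ?_
  · refine Continuous.locallyIntegrable ?_
    rw [Real.fourierInv_eq_fourier_comp_neg]
    exact continuous_fourier_of_integrable h1.comp_neg
  have h3 := Lp.toTemperedDistribution_apply (𝓕⁻ (h2.toLp f) : L2Space n) φ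
  simp only [smul_eq_mul] at h3
  rw [← h3, ← Lp.fourierInv_toTemperedDistribution_eq, TemperedDistribution.fourierInv_apply,
    Lp.toTemperedDistribution_apply, ← integral_fourierInv_mul_eq φ.integrable h1]
  refine integral_congr_ae ?_
  filter_upwards [h2.coeFn_toLp] with x hx
  rw [hx, smul_eq_mul, SchwartzMap.fourierInv_coe]

/-- This pointwise control is what pays for the factor r⁻¹ at low frequency. -/
theorem enorm_fourier_le_eLpNorm_one (f : L2Space n) (hf : MemLp f 1) :
    ∀ᵐ ξ, ‖(𝓕 f : L2Space n) ξ‖ₑ ≤ eLpNorm f 1 volume := by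
  have h := fourier_toLp_ae_eq (memLp_one_iff_integrable.1 hf) (Lp.memLp f)
  rw [Lp.toLp_coeFn] at h
  filter_upwards [h] with ξ hξ
  rw [hξ, eLpNorm_one_eq_lintegral_enorm,
    ← ofReal_integral_norm_eq_lintegral_enorm (memLp_one_iff_integrable.1 hf), ← ofReal_norm]
  exact ENNReal.ofReal_le_ofReal (norm_fourier_le_integral_norm _ _)

/-- A modulated Gaussian, the Fourier transform of a translated heat kernel at time `s`. -/
def modulatedGaussian (s : ℝ) (x ξ : EuclideanSpace ℝ (Fin n)) : ℂ :=
  Complex.exp (-((s * (2 * Real.pi) ^ 2 : ℝ) : ℂ) * ‖ξ‖ ^ 2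
    + 2 * Real.pi * Complex.I * (inner ℝ (-x) ξ : ℝ))

theorem norm_modulatedGaussian (s : ℝ) (x ξ : EuclideanSpace ℝ (Fin n)) :
    ‖modulatedGaussian s x ξ‖ = Real.exp (-(s * freq ξ ^ 2)) := by
  rw [modulatedGaussian, Complex.norm_exp]
  congr 1
  have h : (-((s * (2 * Real.pi) ^ 2 : ℝ) : ℂ) * ‖ξ‖ ^ 2
      + 2 * Real.pi * Complex.I * (inner ℝ (-x) ξ : ℝ))
      = ((-(s * freq ξ ^ 2) : ℝ) : ℂ) + ((2 * Real.pi * inner ℝ (-x) ξ : ℝ) : ℂ) * Complex.I := by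
    unfold freq; push_cast; ring
  rw [h]
  simp only [Complex.add_re, Complex.ofReal_re, Complex.re_ofReal_mul, Complex.I_re, mul_zero,
    add_zero]

theorem integrable_modulatedGaussian {s : ℝ} (hs : 0 < s) (x : EuclideanSpace ℝ (Fin n)) :
    Integrable (modulatedGaussian s x) :=
  GaussianFourier.integrable_cexp_neg_mul_sq_norm_add
    (by rw [Complex.ofReal_re]; positivity) _ _

theorem memLp_modulatedGaussian {s : ℝ} (hs : 0 < s) (x : EuclideanSpace ℝ (Fin n)) :
    MemLp (modulatedGaussian s x) 2 := by
  rw [memLp_two_iff_integrable_sq_norm (integrable_modulatedGaussian hs x).aestronglyMeasurable]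
  refine ((integrable_modulatedGaussian (s := 2 * s) (by positivity) x).norm).congr
    (Filter.Eventually.of_forall fun ξ => ?_)
  simp only [norm_modulatedGaussian]
  rw [← Real.exp_nat_mul]
  congr 1; push_cast; ring

theorem conj_modulatedGaussian (s : ℝ) (x ξ : EuclideanSpace ℝ (Fin n)) :
    (starRingEnd ℂ) (modulatedGaussian s x ξ)
      = Complex.exp (((2 * Real.pi * inner ℝ ξ x : ℝ) : ℂ) * Complex.I)
        * (Real.exp (-(s * freq ξ ^ 2)) : ℝ) := by
  rw [modulatedGaussian, ← Complex.exp_conj, Complex.ofReal_exp, ← Complex.exp_add]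
  congr 1
  simp only [map_add, map_mul, map_neg, map_pow, Complex.conj_ofReal, Complex.conj_I,
    inner_neg_left, real_inner_comm x ξ, freq, map_ofNat]
  push_cast
  ring

theorem fourierInv_modulatedGaussian {s : ℝ} (hs : 0 < s) (x y : EuclideanSpace ℝ (Fin n)) :
    𝓕⁻ (modulatedGaussian s x) y
      = ((1 / (4 * Real.pi * s) ^ ((n : ℝ) / 2) * Real.exp (-‖x - y‖ ^ 2 / (4 * s)) : ℝ) : ℂ) := by
  have hb : 0 < (((s * (2 * Real.pi) ^ 2 : ℝ) : ℂ)).re := by rw [Complex.ofReal_re]; positivity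
  have h := fourier_gaussian_innerProductSpace' hb (-x) (-y)
  rw [Real.fourierInv_eq_fourier_neg]
  unfold modulatedGaussian
  rw [h, finrank_euclideanSpace_fin]
  have h1 : ((Real.pi : ℂ) / ((s * (2 * Real.pi) ^ 2 : ℝ) : ℂ))
      = ((4 * Real.pi * s)⁻¹ : ℝ) := by
    rw [← Complex.ofReal_div]
    congr 1
    field_simp
    ring
  have h2 : ((n : ℂ) / 2) = (((n : ℝ) / 2 : ℝ) : ℂ) := by push_cast; rfl
  have h3 : ‖-x - -y‖ = ‖x - y‖ := by rw [← norm_neg]; congr 1; abel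
  rw [h1, h2, ← Complex.ofReal_cpow (by positivity), Real.inv_rpow (by positivity), h3, one_div,
    Complex.ofReal_mul (_⁻¹), Complex.ofReal_exp]
  congr 2
  push_cast
  have : (Real.pi : ℂ) ≠ 0 := by exact_mod_cast Real.pi_ne_zero
  have : (s : ℂ) ≠ 0 := by exact_mod_cast hs.ne'
  field_simp
  ring

/-- The heat semigroup at time `s` on the Fourier side. -/
theorem memLp_gaussian_mul {s : ℝ} (hs : 0 ≤ s) (f : L2Space n) :
    MemLp (fun ξ => ((Real.exp (-(s * freq ξ ^ 2)) : ℝ) : ℂ) * f ξ) 2 := by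
  have hc : Continuous fun ξ : EuclideanSpace ℝ (Fin n) =>
      ((Real.exp (-(s * freq ξ ^ 2)) : ℝ) : ℂ) := by
    have := continuous_freq (n := n)
    fun_prop
  refine (Lp.memLp f).of_le (hc.aestronglyMeasurable.mul (Lp.aestronglyMeasurable f))
    (Filter.Eventually.of_forall fun ξ => ?_)
  rw [norm_mul, Complex.norm_real, Real.norm_of_nonneg (Real.exp_nonneg _)]
  refine mul_le_of_le_one_left (norm_nonneg _) (Real.exp_le_one_iff.2 ?_)
  have : 0 ≤ s * freq ξ ^ 2 := by positivity
  linarith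

/-- The heat kernel centred at x is the inverse transform of a modulated Gaussian, so the
convolution is an L² inner product and Parseval applies. Only J ∈ L² is needed, as befits a datum
containing Δψ₀. -/
theorem integral_heatKernel_mul {s : ℝ} (hs : 0 < s) (J : L2Space n)
    (x : EuclideanSpace ℝ (Fin n)) :
    ((1 / (4 * Real.pi * s) ^ ((n : ℝ) / 2) : ℝ) : ℂ)
        * ∫ y, ((Real.exp (-‖x - y‖ ^ 2 / (4 * s)) : ℝ) : ℂ) * J y
      = 𝓕⁻ (fun ξ => ((Real.exp (-(s * freq ξ ^ 2)) : ℝ) : ℂ) * (𝓕 J : L2Space n) ξ) x := by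
  set G : L2Space n := (memLp_modulatedGaussian hs x).toLp _ with hG
  have hGa : G =ᵐ[volume] modulatedGaussian s x := MemLp.coeFn_toLp _
  have hGi : (𝓕⁻ G : L2Space n) =ᵐ[volume] 𝓕⁻ (modulatedGaussian s x) :=
    fourierInv_toLp_ae_eq (integrable_modulatedGaussian hs x) _
  have h := Lp.inner_fourier_eq (𝓕⁻ G : L2Space n) J
  rw [FourierTransform.fourier_fourierInv_eq, L2.inner_def, L2.inner_def] at h
  rw [Real.fourierInv_eq', ← integral_const_mul]
  refine Eq.trans ?_ (h.symm.trans ?_)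
  · refine integral_congr_ae ?_
    filter_upwards [hGi] with y hy
    rw [hy, fourierInv_modulatedGaussian hs, RCLike.inner_apply, Complex.conj_ofReal]
    push_cast; ring
  · refine integral_congr_ae ?_
    filter_upwards [hGa] with ξ hξ
    rw [hξ, RCLike.inner_apply, conj_modulatedGaussian, smul_eq_mul]
    ring

theorem heatLayer_congr {J J' : EuclideanSpace ℝ (Fin n) → ℂ} (h : J =ᵐ[volume] J') (γ κ t : ℝ) :
    heatLayer γ κ J t =ᵐ[volume] heatLayer γ κ J' t := by
  unfold heatLayer
  split_ifs with ht
  · filter_upwards [h] with x hx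
    rw [hx]
  · refine Filter.Eventually.of_forall fun x => ?_
    dsimp only
    congr 1
    refine integral_congr_ae ?_
    filter_upwards [h] with y hy
    rw [hy]

/-- The heat layer is an `L²` function whose Fourier transform decays like a Gaussian. -/
theorem exists_heatLayer_ae_eq (γ : ℝ) {κ t : ℝ} (hκ : 0 < κ) (ht : 0 ≤ t) (J : L2Space n) :
    ∃ H : L2Space n, heatLayer γ κ J t =ᵐ[volume] H ∧
      ∀ᵐ ξ, (𝓕 H : L2Space n) ξ
        = (((γ - 1) * Real.exp (-(κ * freq ξ ^ 2) * t) : ℝ) : ℂ) * (𝓕 J : L2Space n) ξ := by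
  have hs : 0 ≤ κ * t := by positivity
  have hM := memLp_gaussian_mul hs (𝓕 J : L2Space n)
  refine ⟨((γ - 1 : ℝ) : ℂ) • (𝓕⁻ (hM.toLp _) : L2Space n), ?_, ?_⟩
  · rcases ht.eq_or_lt with rfl | ht
    · have e : hM.toLp _ = (𝓕 J : L2Space n) := by
        apply Lp.ext
        filter_upwards [hM.coeFn_toLp] with ξ hξ
        rw [hξ]; simp
      rw [e, FourierTransform.fourierInv_fourier_eq]
      filter_upwards [Lp.coeFn_smul (((γ - 1 : ℝ) : ℂ)) J] with x hx
      rw [hx, heatLayer, if_pos rfl, Pi.smul_apply, smul_eq_mul]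
    · have hs : 0 < κ * t := by positivity
      -- A product of two L² functions, the Gaussian being the modulated one centred at 0;
      -- integrability allows the pointwise inversion integral.
      have hI : Integrable fun ξ => ((Real.exp (-(κ * t * freq ξ ^ 2)) : ℝ) : ℂ)
          * (𝓕 J : L2Space n) ξ := by
        refine ((memLp_modulatedGaussian hs 0).integrable_mul (Lp.memLp (𝓕 J : L2Space n))).congr
          (Filter.Eventually.of_forall fun ξ => ?_)
        simp only [Pi.mul_apply]
        congr 1
        simp only [modulatedGaussian, freq]
        rw [Complex.ofReal_exp]
        congr 1
        simp; ring
      filter_upwards [Lp.coeFn_smul (((γ - 1 : ℝ) : ℂ)) (𝓕⁻ (hM.toLp _) : L2Space n),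
        fourierInv_toLp_ae_eq hI hM] with x hx hx'
      rw [hx, Pi.smul_apply, hx', ← integral_heatKernel_mul hs, heatLayer, if_neg ht.ne', smul_eq_mul,
        ← mul_assoc (b := ((1 / _ : ℝ) : ℂ)), ← Complex.ofReal_mul]
      simp only [← mul_assoc]
      rw [mul_one_div]
  · rw [FourierTransform.fourier_smul, FourierTransform.fourier_fourierInv_eq]
    filter_upwards [Lp.coeFn_smul (((γ - 1 : ℝ) : ℂ)) (hM.toLp _), hM.coeFn_toLp] with ξ h1 h2
    have e : -(κ * freq ξ ^ 2) * t = -(κ * t * freq ξ ^ 2) := by ring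
    rw [h1, Pi.smul_apply, h2, smul_eq_mul, e, Complex.ofReal_mul (γ - 1), mul_assoc ((γ - 1 : ℝ) : ℂ)]

theorem fourier_l2Laplacian_ae_eq (f : L2Space n)
    (hf : TemperedDistribution.MemSobolev 2 2 (f : TDist n)) :
    ∀ᵐ ξ, (𝓕 (l2Laplacian f) : L2Space n) ξ
      = ((-freq ξ ^ 2 : ℝ) : ℂ) * (𝓕 f : L2Space n) ξ := by
  have h := fourier_ae_eq_of_defect (u := l2Laplacian f) (m := fun r => -r ^ 2) (k := fun _ => 0)
    (f := 𝓕 f) (g := 0) (by fun_prop) continuous_const fun φ hφ => by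
      have e : (fun r : ℝ => -r ^ 2) = fun r => (-1) * (r ^ 2 * 1) := by funext r; ring
      rw [defect, coe_l2Laplacian f hf, fourier_laplacian_apply, fourier_L2_eq_multPair, multPair_zero,
        e, multPair_const_mul, multPair_sq_mul]
      push_cast; ring
  filter_upwards [h] with ξ hξ
  rw [hξ]; simp

/-! ### From mode bounds to Sobolev and L¹ norms -/

/-- The part of `1 / (2π|ξ|)` in the unit ball of angular frequencies. -/
def lowFreqInv (ξ : EuclideanSpace ℝ (Fin n)) : ℝ := if freq ξ ≤ 1 then (freq ξ)⁻¹ else 0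

theorem aestronglyMeasurable_lowFreqInv :
    AEStronglyMeasurable (lowFreqInv (n := n)) volume := by
  have := (continuous_freq (n := n)).measurable
  exact (Measurable.ite (measurableSet_le this measurable_const) this.inv
    measurable_const).aestronglyMeasurable

/-- The square is of order |ξ|⁻² near the origin, which is locally integrable exactly because n > 2.
-/
theorem memLp_lowFreqInv (hn : 3 ≤ n) : MemLp (lowFreqInv (n := n)) 2 := by
  rw [memLp_two_iff_integrable_sq_norm aestronglyMeasurable_lowFreqInv]
  have hd : Module.finrank ℝ (EuclideanSpace ℝ (Fin n)) = n := finrank_euclideanSpace_fin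
  have hm : AEStronglyMeasurable (fun ξ : EuclideanSpace ℝ (Fin n) => (freq ξ)⁻¹ ^ 2) volume :=
    ((continuous_freq (n := n)).measurable.inv.pow_const 2).aestronglyMeasurable
  have h := locallyIntegrable_of_norm_le_rpow (μ := (volume : Measure (EuclideanSpace ℝ (Fin n))))
    (f := fun ξ => (freq ξ)⁻¹ ^ 2) (C := ((2 * Real.pi) ^ 2)⁻¹) (α := 2)
    (by rw [hd]; omega) (by rw [hd]; exact_mod_cast (by omega : 2 < n))
    (Filter.Eventually.of_forall fun ξ => by
      rw [Real.norm_of_nonneg (by positivity), Real.rpow_neg (norm_nonneg _), freq, Real.rpow_two,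
        ← mul_inv, ← mul_pow, inv_pow]) hm
  have hc : IsCompact {ξ : EuclideanSpace ℝ (Fin n) | freq ξ ≤ 1} := by
    refine (isCompact_closedBall (0 : EuclideanSpace ℝ (Fin n)) 1).of_isClosed_subset
      (isClosed_le continuous_freq continuous_const) fun ξ hξ => ?_
    rw [mem_closedBall_zero_iff]
    have h1 : 2 * Real.pi * ‖ξ‖ ≤ 1 := hξ
    nlinarith [Real.pi_gt_three, norm_nonneg ξ]
  refine ((h.integrableOn_isCompact hc).integrable_indicator hc.measurableSet).congr
    (Filter.Eventually.of_forall fun ξ => ?_)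
  by_cases hξ : freq ξ ≤ 1
  · simp [lowFreqInv, hξ]
  · simp [lowFreqInv, hξ]

theorem one_add_sq_rpow_half (r : ℝ) (k : ℕ) :
    (1 + r ^ 2) ^ ((2 * k + 1 : ℕ) / 2 : ℝ) = (1 + r ^ 2) ^ k * √(1 + r ^ 2) := by
  rw [Real.sqrt_eq_rpow, ← Real.rpow_natCast (1 + r ^ 2) k, ← Real.rpow_add (by positivity)]
  congr 1; push_cast; ring

/-- Uniform bounds of the two error multipliers by Sobolev weights. -/
theorem exists_mode_error_weighted_bound {a γ : ℝ} (ha : 0 < a) (hγ : 1 < γ) (hγ' : γ ≤ 2) :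
    ∃ κ₀ : ℝ, 0 < κ₀ ∧ ∃ C : ℝ, 0 < C ∧ ∀ κ r, 0 < κ → κ ≤ κ₀ → 0 < r → ∀ t, 0 ≤ t →
      (∀ M : ModeFamily a γ κ 1 0,
        |modeError γ κ r (a * r ^ 2) (fun t => M.u t r) (fun t => M.z t r) (fun t => M.w t r) t|
          ≤ C * (κ * √κ) * (1 + r ^ 2) ^ (5 / 2 : ℝ)) ∧
      (∀ N : ModeFamily a γ κ 0 1,
        |modeError γ κ r 1 (fun t => N.u t r) (fun t => N.z t r) (fun t => N.w t r) t|
          ≤ C * (κ * √κ) * ((1 + r ^ 2) ^ (3 / 2 : ℝ) + if r ≤ 1 then r⁻¹ else 0)) := by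
  obtain ⟨κ₀, hκ₀, C, hC, h⟩ := exists_mode_error_bound ha hγ hγ'
  refine ⟨κ₀, hκ₀, C * (4 + a), by positivity, fun κ r hκ hκ' hr t ht => ⟨fun M => ?_, fun N => ?_⟩⟩
  · have h1 := h κ r 1 0 hκ hκ' hr _ _ _ _ _ _ _ (M.system r) t ht
    rw [zero_add, mul_one, abs_one, mul_one,
      abs_of_nonneg (by positivity : 0 ≤ a * r ^ 2)] at h1
    have e := one_add_sq_rpow_half r 2
    norm_num at e
    rw [e]
    have s1 : 1 ≤ √(1 + r ^ 2) := Real.one_le_sqrt.2 (by nlinarith)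
    have s2 : r ≤ √(1 + r ^ 2) := Real.le_sqrt_of_sq_le (by linarith)
    refine le_of_mul_le_mul_left (h1.trans ?_) hr
    -- With data (1,0) the right side r + ar² contains a factor r, so nothing singular remains after
    -- division. The leftover 1 + ar costs half a power of 1 + r², raising 2 to 5/2.
    have h2 : 1 + a * r ≤ (4 + a) * √(1 + r ^ 2) := by nlinarith
    calc C * (κ * √κ) * (1 + r ^ 2) ^ 2 * (r + a * r ^ 2)
        = C * (κ * √κ) * (1 + r ^ 2) ^ 2 * r * (1 + a * r) := by ring
      _ ≤ C * (κ * √κ) * (1 + r ^ 2) ^ 2 * r * ((4 + a) * √(1 + r ^ 2)) := by gcongr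
      _ = _ := by ring
  · have h1 := h κ r 0 1 hκ hκ' hr _ _ _ _ _ _ _ (N.system r) t ht
    rw [mul_zero, add_zero, abs_zero, mul_zero, zero_add, abs_one, mul_one] at h1
    have e := one_add_sq_rpow_half r 1
    norm_num at e
    rw [e]
    refine le_of_mul_le_mul_left (h1.trans ?_) hr
    -- With data (0,1) the right side has no factor r: for r ≤ 1 the division leaves r⁻¹, while for
    -- r > 1 it gains half a power of 1 + r², lowering 2 to 3/2.
    split_ifs with hr1
    · have h2 : (1 + r ^ 2) ^ 2 ≤ 4 := by
        have : r ^ 2 ≤ 1 := pow_le_one₀ hr.le hr1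
        nlinarith [sq_nonneg r]
      calc C * (κ * √κ) * (1 + r ^ 2) ^ 2 ≤ C * (κ * √κ) * 4 := by gcongr
        _ ≤ C * (κ * √κ) * ((4 + a) * (r * ((1 + r ^ 2) * √(1 + r ^ 2)) + 1)) := by
          gcongr
          have : 0 ≤ r * ((1 + r ^ 2) * √(1 + r ^ 2)) := by positivity
          nlinarith
        _ = _ := by field_simp
    · push Not at hr1
      have h2 : √(1 + r ^ 2) ≤ (4 + a) * r := by
        rw [Real.sqrt_le_left (by positivity)]
        nlinarith [mul_pos ha hr]
      have h3 := Real.mul_self_sqrt (by positivity : 0 ≤ 1 + r ^ 2)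
      calc C * (κ * √κ) * (1 + r ^ 2) ^ 2
          = C * (κ * √κ) * ((1 + r ^ 2) * √(1 + r ^ 2)) * √(1 + r ^ 2) := by
            rw [mul_assoc _ _ (√(1 + r ^ 2)), mul_assoc (1 + r ^ 2), h3]; ring
        _ ≤ C * (κ * √κ) * ((1 + r ^ 2) * √(1 + r ^ 2)) * ((4 + a) * r) := by gcongr
        _ = _ := by ring

theorem eLpNorm_fourier_eq (f : L2Space n) :
    eLpNorm (𝓕 f : L2Space n) 2 volume = eLpNorm f 2 volume := by
  rw [← Lp.enorm_def, ← Lp.enorm_def, ← ofReal_norm, ← ofReal_norm, Lp.norm_fourier_eq]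

theorem sub_expansion_ae_eq (κ : ℝ) (u z w H : L2Space n) :
    ↑↑(u - (z + (κ : ℂ) • w + (κ : ℂ) • H)) =ᵐ[volume]
      fun x => u x - (z x + (κ : ℂ) * w x + (κ : ℂ) * H x) := by
  filter_upwards [Lp.coeFn_sub u (z + (κ : ℂ) • w + (κ : ℂ) • H),
    Lp.coeFn_add (z + (κ : ℂ) • w) ((κ : ℂ) • H), Lp.coeFn_add z ((κ : ℂ) • w),
    Lp.coeFn_smul (κ : ℂ) w, Lp.coeFn_smul (κ : ℂ) H] with x h1 h2 h3 h4 h5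
  rw [h1, Pi.sub_apply, h2, Pi.add_apply, h3, Pi.add_apply, h4, h5]
  rfl

theorem fourier_expansion_error_ae_eq {a γ κ t : ℝ} {ψ₀ ψ₁ J u z w H : L2Space n}
    (M : ModeFamily a γ κ 1 0) (N : ModeFamily a γ κ 0 1)
    (hu : ∀ᵐ ξ, (𝓕 u : L2Space n) ξ = ((M.u t (freq ξ) : ℝ) : ℂ) * (𝓕 ψ₀ : L2Space n) ξ
      + ((N.u t (freq ξ) : ℝ) : ℂ) * (𝓕 ψ₁ : L2Space n) ξ)
    (hz : ∀ᵐ ξ, (𝓕 z : L2Space n) ξ = ((M.z t (freq ξ) : ℝ) : ℂ) * (𝓕 ψ₀ : L2Space n) ξ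
      + ((N.z t (freq ξ) : ℝ) : ℂ) * (𝓕 ψ₁ : L2Space n) ξ)
    (hw : ∀ᵐ ξ, (𝓕 w : L2Space n) ξ = ((M.w t (freq ξ) : ℝ) : ℂ) * (𝓕 ψ₀ : L2Space n) ξ
      + ((N.w t (freq ξ) : ℝ) : ℂ) * (𝓕 ψ₁ : L2Space n) ξ)
    (hH : ∀ᵐ ξ, (𝓕 H : L2Space n) ξ
      = (((γ - 1) * Real.exp (-(κ * freq ξ ^ 2) * t) : ℝ) : ℂ) * (𝓕 J : L2Space n) ξ)
    (hJ : ∀ᵐ ξ, (𝓕 J : L2Space n) ξ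
      = (𝓕 ψ₁ : L2Space n) ξ + ((a * freq ξ ^ 2 : ℝ) : ℂ) * (𝓕 ψ₀ : L2Space n) ξ) :
    ∀ᵐ ξ, (𝓕 (u - (z + (κ : ℂ) • w + (κ : ℂ) • H)) : L2Space n) ξ
      = ((modeError γ κ (freq ξ) (a * freq ξ ^ 2) (fun t => M.u t (freq ξ))
          (fun t => M.z t (freq ξ)) (fun t => M.w t (freq ξ)) t : ℝ) : ℂ) * (𝓕 ψ₀ : L2Space n) ξ
        + ((modeError γ κ (freq ξ) 1 (fun t => N.u t (freq ξ))
          (fun t => N.z t (freq ξ)) (fun t => N.w t (freq ξ)) t : ℝ) : ℂ)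
          * (𝓕 ψ₁ : L2Space n) ξ := by
  have e : (𝓕 (u - (z + (κ : ℂ) • w + (κ : ℂ) • H)) : L2Space n)
      = 𝓕 u - (𝓕 z + (κ : ℂ) • 𝓕 w + (κ : ℂ) • 𝓕 H) := by
    simp only [sub_eq_add_neg, FourierTransform.fourier_add, FourierTransform.fourier_neg,
      FourierTransform.fourier_smul]
  rw [e]
  filter_upwards [sub_expansion_ae_eq κ (𝓕 u) (𝓕 z) (𝓕 w) (𝓕 H), hu, hz, hw, hH, hJ]
    with ξ h0 h1 h2 h3 h4 h5
  rw [h0, h1, h2, h3, h4, h5]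
  unfold modeError
  push_cast
  ring

/-- Weighted multiplier bounds turn into a bound by the norms of `H^5 ∩ L¹` and `H^3 ∩ L¹`. -/
theorem eLpNorm_two_multiplier_le {c : ℝ} (hc : 0 ≤ c) {E₀ E₁ : ℝ → ℝ}
    (h0 : ∀ r, 0 < r → |E₀ r| ≤ c * (1 + r ^ 2) ^ (5 / 2 : ℝ))
    (h1 : ∀ r, 0 < r → |E₁ r| ≤ c * ((1 + r ^ 2) ^ (3 / 2 : ℝ) + if r ≤ 1 then r⁻¹ else 0))
    (hn : 3 ≤ n) {ψ₀ ψ₁ : L2Space n} (hψ₁ : MemLp ψ₁ 1 volume) :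
    eLpNorm (fun ξ => ((E₀ (freq ξ) : ℝ) : ℂ) * (𝓕 ψ₀ : L2Space n) ξ
        + ((E₁ (freq ξ) : ℝ) : ℂ) * (𝓕 ψ₁ : L2Space n) ξ) 2 volume
      ≤ ENNReal.ofReal c * (sobolevENorm 5 ψ₀ + sobolevENorm 3 ψ₁
        + eLpNorm (lowFreqInv (n := n)) 2 volume * eLpNorm ψ₁ 1 volume) := by
  have : Nontrivial (EuclideanSpace ℝ (Fin n)) := by
    have : Nonempty (Fin n) := ⟨⟨0, by omega⟩⟩
    infer_instance
  set W : ℝ → EuclideanSpace ℝ (Fin n) → ℂ :=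
    fun s ξ => (((1 + (2 * Real.pi * ‖ξ‖) ^ 2) ^ (s / 2) : ℝ) : ℂ) with hW
  have hWc : ∀ s, Continuous (W s) := fun s => by
    refine Complex.continuous_ofReal.comp (Continuous.rpow_const (by fun_prop) fun ξ => Or.inl ?_)
    positivity
  have hWn : ∀ s ξ, ‖W s ξ‖ = (1 + freq ξ ^ 2) ^ (s / 2) := fun s ξ => by
    rw [hW, Complex.norm_real, Real.norm_of_nonneg (by positivity), freq]
  set m : ℝ := (eLpNorm ψ₁ 1 volume).toReal with hm
  have hmE : ENNReal.ofReal m = eLpNorm ψ₁ 1 volume := ENNReal.ofReal_toReal hψ₁.2.ne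
  have hm0 : 0 ≤ m := ENNReal.toReal_nonneg
  set A : EuclideanSpace ℝ (Fin n) → ℝ := fun ξ => ‖W 5 ξ * (𝓕 ψ₀ : L2Space n) ξ‖
  set B : EuclideanSpace ℝ (Fin n) → ℝ := fun ξ => ‖W 3 ξ * (𝓕 ψ₁ : L2Space n) ξ‖
  set D : EuclideanSpace ℝ (Fin n) → ℝ := fun ξ => m * lowFreqInv ξ
  have hA : AEStronglyMeasurable A volume :=
    ((hWc 5).aestronglyMeasurable.mul (Lp.aestronglyMeasurable _)).norm
  have hB : AEStronglyMeasurable B volume :=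
    ((hWc 3).aestronglyMeasurable.mul (Lp.aestronglyMeasurable _)).norm
  have hD : AEStronglyMeasurable D volume := aestronglyMeasurable_lowFreqInv.const_mul m
  have hAB : AEStronglyMeasurable (A + B) volume := hA.add hB
  have hl0 : ∀ ξ : EuclideanSpace ℝ (Fin n), 0 ≤ lowFreqInv ξ := fun ξ => by
    unfold lowFreqInv
    have := freq_nonneg ξ
    split_ifs <;> positivity
  have hpt : ∀ᵐ ξ, ‖((E₀ (freq ξ) : ℝ) : ℂ) * (𝓕 ψ₀ : L2Space n) ξ
        + ((E₁ (freq ξ) : ℝ) : ℂ) * (𝓕 ψ₁ : L2Space n) ξ‖ ≤ c * ‖(A + B + D) ξ‖ := by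
    have hne : ∀ᵐ ξ : EuclideanSpace ℝ (Fin n), ξ ≠ 0 := Measure.ae_ne volume 0
    -- The multiplier bounds hold only for r > 0; the origin is a null set.
    filter_upwards [hne, enorm_fourier_le_eLpNorm_one ψ₁ hψ₁] with ξ hξ hs
    have hr : 0 < freq ξ := by unfold freq; positivity
    have hs' : ‖(𝓕 ψ₁ : L2Space n) ξ‖ ≤ m := by
      rw [← hmE, ← ofReal_norm] at hs
      exact (ENNReal.ofReal_le_ofReal_iff hm0).1 hs
    have hABD : ‖(A + B + D) ξ‖ = A ξ + B ξ + D ξ :=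
      Real.norm_of_nonneg (by
        have := hl0 ξ
        simp only [Pi.add_apply, A, B, D]; positivity)
    rw [hABD]
    simp only [A, B, D, norm_mul, hWn]
    refine (norm_add_le _ _).trans ?_
    rw [norm_mul, norm_mul, Complex.norm_real, Complex.norm_real, Real.norm_eq_abs,
      Real.norm_eq_abs]
    have g0 := h0 _ hr
    have g1 := h1 _ hr
    calc _ ≤ c * (1 + freq ξ ^ 2) ^ (5 / 2 : ℝ) * ‖(𝓕 ψ₀ : L2Space n) ξ‖
          + c * ((1 + freq ξ ^ 2) ^ (3 / 2 : ℝ) + lowFreqInv ξ) * ‖(𝓕 ψ₁ : L2Space n) ξ‖ := by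
          gcongr
          exact g1
      _ = c * ((1 + freq ξ ^ 2) ^ (5 / 2 : ℝ) * ‖(𝓕 ψ₀ : L2Space n) ξ‖
          + (1 + freq ξ ^ 2) ^ (3 / 2 : ℝ) * ‖(𝓕 ψ₁ : L2Space n) ξ‖
          + ‖(𝓕 ψ₁ : L2Space n) ξ‖ * lowFreqInv ξ) := by ring
      _ ≤ _ := by
          have := hl0 ξ
          gcongr
  refine (eLpNorm_le_mul_eLpNorm_of_ae_le_mul hpt 2).trans ?_
  gcongr
  have one_le : (1 : ℝ≥0∞) ≤ 2 := by norm_num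
  refine (eLpNorm_add_le hAB hD one_le).trans ?_
  refine add_le_add ((eLpNorm_add_le hA hB one_le).trans ?_) ?_
  · simp only [A, B]
    rw [eLpNorm_norm, eLpNorm_norm]
    rfl
  · rw [mul_comm, ← hmE]
    refine eLpNorm_le_mul_eLpNorm_of_ae_le_mul (Filter.Eventually.of_forall fun ξ => ?_) 2
    simp only [D]
    rw [norm_mul, Real.norm_of_nonneg hm0]

end

/-! ### Assembly of the main estimate -/

theorem mainTheorem4 (n : ℕ) (hn : 3 ≤ n) (b ν γ : ℝ) (hb : 0 < b) (hν : 0 < ν)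
    (hγ : 1 < γ) (hγ' : γ ≤ 5 / 3) :
    ∃ κ₀ : ℝ, 0 < κ₀ ∧ ∃ C : ℝ, 0 < C ∧
      ∀ κ : ℝ, 0 < κ → κ ≤ κ₀ →
      ∀ (ψ₀ ψ₁ : L2Space n) (ψ₂ : TDist n),
        TemperedDistribution.MemSobolev 5 2 (ψ₀ : TDist n) → MemLp ψ₀ 1 volume →
        TemperedDistribution.MemSobolev 3 2 (ψ₁ : TDist n) → MemLp ψ₁ 1 volume →
        ψ₂ = ((b * ν : ℝ) : ℂ) • Δ (ψ₁ : TDist n) + Δ (ψ₀ : TDist n) →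
      ∀ (ψ ψz ψI : ℝ → L2Space n) (ψzt ψIt : ℝ → TDist n),
        IsBlackstockSolution b ν γ κ (ψ₀ : TDist n) (ψ₁ : TDist n) ψ₂ ψ →
        IsViscoelasticSolution (b * ν) (ψ₀ : TDist n) (ψ₁ : TDist n) (fun _ => 0) ψz ψzt →
        IsViscoelasticSolution (b * ν)
          (((1 - γ : ℝ) : ℂ) • ((ψ₁ : TDist n) - ((b * ν : ℝ) : ℂ) • Δ (ψ₀ : TDist n))) 0
          (fun t => ((γ - 1 : ℝ) : ℂ) • Δ (ψzt t - ((b * ν : ℝ) : ℂ) • Δ (ψz t : TDist n))) ψI ψIt →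
      ∀ t : ℝ, 0 ≤ t →
        eLpNorm (fun x => ψ t x - (ψz t x + (κ : ℂ) * ψI t x
            + (κ : ℂ) * heatLayer γ κ (fun y => ψ₁ y - ((b * ν : ℝ) : ℂ) * l2Laplacian ψ₀ y) t x))
          2 volume
        ≤ ENNReal.ofReal (C * (κ * Real.sqrt κ)) *
            (sobolevL1ENorm 5 ψ₀ + sobolevL1ENorm 3 ψ₁) := by
  obtain ⟨κ₀, hκ₀, C, hC, hbound⟩ :=
    exists_mode_error_weighted_bound (mul_pos hb hν) hγ (by linarith)
  have hL : eLpNorm (lowFreqInv (n := n)) 2 volume ≠ ∞ := (memLp_lowFreqInv hn).2.ne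
  set L : ℝ := (eLpNorm (lowFreqInv (n := n)) 2 volume).toReal with hLdef
  have hL0 : 0 ≤ L := ENNReal.toReal_nonneg
  -- L is the L² norm of the low-frequency singularity; it multiplies the L¹ norm of ψ₁.
  refine ⟨κ₀, hκ₀, C * (1 + L), by positivity, ?_⟩
  intro κ hκ hκ' ψ₀ ψ₁ ψ₂ hs₀ _ _ hl₁ h2 ψ ψz ψI ψzt ψIt hB hV hI t ht
  obtain ⟨M⟩ := nonempty_modeFamily (b * ν) γ κ 1 0
  obtain ⟨N⟩ := nonempty_modeFamily (b * ν) γ κ 0 1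
  set J : L2Space n := ψ₁ - ((b * ν : ℝ) : ℂ) • l2Laplacian ψ₀ with hJdef
  have hJ : (fun y => ψ₁ y - ((b * ν : ℝ) : ℂ) * l2Laplacian ψ₀ y) =ᵐ[volume] J := by
    filter_upwards [Lp.coeFn_sub ψ₁ (((b * ν : ℝ) : ℂ) • l2Laplacian ψ₀),
      Lp.coeFn_smul ((b * ν : ℝ) : ℂ) (l2Laplacian ψ₀)] with y h3 h4
    rw [hJdef, h3, Pi.sub_apply, h4]
    rfl
  have hJF : ∀ᵐ ξ, (𝓕 J : L2Space n) ξ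
      = (𝓕 ψ₁ : L2Space n) ξ + ((b * ν * freq ξ ^ 2 : ℝ) : ℂ) * (𝓕 ψ₀ : L2Space n) ξ := by
    have e : (𝓕 J : L2Space n) = 𝓕 ψ₁ - ((b * ν : ℝ) : ℂ) • 𝓕 (l2Laplacian ψ₀) := by
      simp only [hJdef, sub_eq_add_neg, FourierTransform.fourier_add,
        FourierTransform.fourier_neg, FourierTransform.fourier_smul]
    rw [e]
    filter_upwards [Lp.coeFn_sub (𝓕 ψ₁ : L2Space n) (((b * ν : ℝ) : ℂ) • 𝓕 (l2Laplacian ψ₀)),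
      Lp.coeFn_smul ((b * ν : ℝ) : ℂ) (𝓕 (l2Laplacian ψ₀) : L2Space n),
      fourier_l2Laplacian_ae_eq ψ₀ (hs₀.mono (by norm_num))] with ξ h3 h4 h5
    rw [h3, Pi.sub_apply, h4, Pi.smul_apply, h5, smul_eq_mul]
    push_cast; ring
  obtain ⟨H, hH, hHF⟩ := exists_heatLayer_ae_eq γ hκ ht J
  have herr := fourier_expansion_error_ae_eq M N (blackstock_fourier rfl h2 hB M N t ht)
    (fourier_ae_eq_of_defect (M.cont_z.slice t) (N.cont_z.slice t)
      fun φ hφ => (viscoelastic_defect hV M N t ht φ hφ).1)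
    (corrector_fourier hV hI M N t ht) hHF hJF
  have hfun : (fun x => ψ t x - (ψz t x + (κ : ℂ) * ψI t x
      + (κ : ℂ) * heatLayer γ κ (fun y => ψ₁ y - ((b * ν : ℝ) : ℂ) * l2Laplacian ψ₀ y) t x))
      =ᵐ[volume] ↑↑(ψ t - (ψz t + (κ : ℂ) • ψI t + (κ : ℂ) • H)) := by
    filter_upwards [sub_expansion_ae_eq κ (ψ t) (ψz t) (ψI t) H, hH,
      heatLayer_congr hJ γ κ t] with x h3 h4 h5
    rw [h3, h5, h4]
  -- Plancherel turns the error into two multipliers acting on 𝓕ψ₀ and 𝓕ψ₁, each bounded uniformly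
  -- in t.
  rw [eLpNorm_congr_ae hfun, ← eLpNorm_fourier_eq, eLpNorm_congr_ae herr]
  have hc : 0 ≤ C * (κ * √κ) := by positivity
  refine (eLpNorm_two_multiplier_le hc
    (E₀ := fun r => modeError γ κ r (b * ν * r ^ 2) (fun t => M.u t r) (fun t => M.z t r)
      (fun t => M.w t r) t)
    (E₁ := fun r => modeError γ κ r 1 (fun t => N.u t r) (fun t => N.z t r) (fun t => N.w t r) t)
    (fun r hr => (hbound κ r hκ hκ' hr t ht).1 M) (fun r hr => (hbound κ r hκ hκ' hr t ht).2 N)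
    hn hl₁).trans ?_
  rw [show C * (1 + L) * (κ * √κ) = C * (κ * √κ) * (1 + L) by ring, ENNReal.ofReal_mul hc, mul_assoc,
    ENNReal.ofReal_add zero_le_one hL0, ENNReal.ofReal_one, ← ENNReal.ofReal_toReal hL, ← hLdef]
  gcongr
  unfold sobolevL1ENorm
  rw [add_mul, one_mul]
  refine add_le_add (add_le_add le_self_add le_self_add) ?_
  gcongr
  exact le_add_self.trans le_add_self
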